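/- A \emph{cost function} is a computable function $c:\mathbb N\times\mathbb N\to\{q\in\mathbb Q: q\ge 0\}$; put $\underline c(x)=\liminf_s c(x,s)\in[0,\infty]$. It is \emph{nondecreasing in the stage} if $c(x,s)=0$ for $x>s$ and $c(x,s)\le c(x,s+1)$ for all $x,s$ (then $\underline c(x)=\sup_s c(x,s)$); \emph{nonincreasing in the main argument} if $c(x+1,s)\le c(x,s)$ for all $x,s$; and \emph{proper} if for every $x$ there is $t$ with $c(x,t)>0$. It satisfies the \emph{limit condition} if $\lim_x\underline c(x)=0$. A \emph{computable approximation} of a set $A\subseteq\mathbb N$ is a computable sequence $(A_s)_{s\in\mathbb N}$ of finite sets with $\lim_s A_s(x)=A(x)$ for each $x$; the sets having one are exactly the $\Delta^0_2$ sets. For $s>0$ let $c_s(A_s)=c(x,s)$ if $x<s$ is least such that $A_{s-1}(x)\ne A_s(x)$, and $c_s(A_s)=0$ if there is no such $x$. A $\Delta^0_2$ set $A$ \emph{obeys} $c$ if some computable approximation $(A_s)$ of $A$ satisfies $\sum_{s>0}c_s(A_s)<\infty$. Write $c\to d$ if every $\Delta^0_2$ set that obeys $c$ also obeys $d$. \textbf{Theorem.}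 Let $c$ and $d$ be cost functions that are nondecreasing in the stage, and suppose that $c$ satisfies the limit condition. (1) If there is $N\in\mathbb N$ such that $N\,\underline c(x)>\underline d(x)$ for all $x$, then $c\to d$. (2) If, moreover, $d$ is nonincreasing in the main argument, $c$ is proper, and $\underline d(x)<\infty$ for all $x$, then $$c\to d\iff \exists N\in\mathbb N\ \forall x\ \bigl[N\,\underline c(x)>\underline d(x)\bigr].$$ -/

import Mathlib

open Filter Topology
open scoped NNReal ENNReal

/-- A cost function: a computable function `ℕ × ℕ → {q ∈ ℚ | q ≥ 0}`. Computability of a function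
with values in the nonnegative rationals means that the numerator and the denominator of the value
(in lowest terms) are computable functions of the arguments. -/
structure CostFunction where
  /-- The cost `c(x, s)` of a change at `x` at stage `s`. -/
  cost : ℕ → ℕ → ℚ≥0
  computable_num : Computable₂ fun x s => (cost x s).num
  computable_den : Computable₂ fun x s => (cost x s).den

namespace CostFunction

/-- `c(x, s)` as an extended nonnegative real number. -/
noncomputable def ecost (c : CostFunction) (x s : ℕ) : ℝ≥0∞ := ((c.cost x s : ℝ≥0) : ℝ≥0∞)

/-- The limit function `x ↦ liminf_s c(x, s)`, with values in `[0, ∞]`. -/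
noncomputable def limit (c : CostFunction) (x : ℕ) : ℝ≥0∞ := liminf (fun s => c.ecost x s) atTop

/-- `c` is nondecreasing in the stage. -/
def NondecreasingInStage (c : CostFunction) : Prop :=
  (∀ x s, s < x → c.cost x s = 0) ∧ ∀ x s, c.cost x s ≤ c.cost x (s + 1)

/-- `c` is nonincreasing in the main argument. -/
def NonincreasingInMain (c : CostFunction) : Prop :=
  ∀ x s, c.cost (x + 1) s ≤ c.cost x s

/-- `c` is proper: for each `x` the cost `c(x, t)` is positive for some `t`. -/
def Proper (c : CostFunction) : Prop :=
  ∀ x, ∃ t, 0 < c.cost x t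

/-- The limit condition: `lim_x liminf_s c(x, s) = 0`. -/
def LimitCondition (c : CostFunction) : Prop :=
  Tendsto c.limit atTop (𝓝 0)

/-- For a cost function that is nondecreasing in the stage, the limit function is
`x ↦ sup_s c(x, s)`. -/
theorem limit_eq_iSup (c : CostFunction) (hc : c.NondecreasingInStage) (x : ℕ) :
    c.limit x = ⨆ s, c.ecost x s := by
  have hm : Monotone fun s => c.ecost x s := by
    refine monotone_nat_of_le_succ fun s => ?_
    simp only [ecost]
    exact_mod_cast hc.2 x s
  exact (tendsto_atTop_iSup hm).liminf_eq

end CostFunction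

/-- A computable approximation of the set `X`: a computable sequence of finite sets `A 0, A 1, …`
(from `s` one can compute an explicit list of the elements of `A s`) such that, for each `x`,
membership of `x` in `A s` is eventually constant in `s`, with final value membership in `X`. -/
def IsComputableApprox (A : ℕ → Finset ℕ) (X : Set ℕ) : Prop :=
  (∃ L : ℕ → List ℕ, Computable L ∧ ∀ s, (L s).toFinset = A s) ∧
    ∀ x, ∀ᶠ s in atTop, (x ∈ A s ↔ x ∈ X)

open Classical in
/-- The cost of changing `A (s - 1)` to `A s`, meant for `s > 0`: it is `c(x, s)` if `x < s` is
least such that `A (s - 1)` and `A s` differ at `x`, and `0` if there is no such `x`. -/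
noncomputable def changeCost (c : CostFunction) (A : ℕ → Finset ℕ) (s : ℕ) : ℝ≥0∞ :=
  if h : ∃ x, x < s ∧ ¬(x ∈ A (s - 1) ↔ x ∈ A s) then c.ecost (Nat.find h) s else 0

/-- The total cost of all changes: the sum over all stages `s > 0`, indexed by `s + 1`. -/
noncomputable def totalCost (c : CostFunction) (A : ℕ → Finset ℕ) : ℝ≥0∞ :=
  ∑' s : ℕ, changeCost c A (s + 1)

/-- The set `X` obeys `c`: some computable approximation of `X` has finite total cost. (The sets
with a computable approximation are exactly the `Δ⁰₂` sets, so only such sets can obey `c`.) -/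
def Obeys (X : Set ℕ) (c : CostFunction) : Prop :=
  ∃ A : ℕ → Finset ℕ, IsComputableApprox A X ∧ totalCost c A < ⊤

/-- The implication `c → d`: every (`Δ⁰₂`) set that obeys `c` obeys `d`. -/
def CostFunction.Implies (c d : CostFunction) : Prop :=
  ∀ X : Set ℕ, Obeys X c → Obeys X d

/-! For (1), run a given approximation along stages `f w` so late that `N * c` has caught up with
`d` on the relevant elements. Mere thinning does not suffice: `c` need not be monotone in `x`, so
the least net change in a block `[f w, f (w + 1)]` may have been hidden, in the original run, behind
a smaller and cheaper element that changed and changed back. An extra stage therefore flips the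
least `y` that changed anywhere in the block. Both new changes are then charged to `d` at `y`, hence
to `N` times an original change at which `y` was least (`speedup_changeCost_le`).

For the converse in (2), suppose that no `N` works. Arbitrarily far out there are elements that are
cheap for `c` and, by any prescribed factor, dearer for `d` (`hasSuitable`). A finite injury
construction builds a set obeying `c` but not `d`. Requirement `e`, under restraint `r` and with `m
= e + r`, faces a possible approximation `B`. Whenever `B` agrees with the set built so far at the
element under consideration and at the last element flipped, it flips the former, at cost at most
`2^-m`. It stops once it has spent `2 * 2^-m`, so it spends at most `3 * 2^-m` under that restraint,
and the sum over all `e` and `r` is finite (`totalCost_approx_lt_top`).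

If `B` converges to the set built, it must answer every flip except possibly the last, each time
paying at least `4^m` times the cost of the flip (`opponentPays`). As the requirement does exhaust
its allowance (`exists_two_le_spent`), `B` pays at least `2^m`. Every computable sequence has
arbitrarily large indices `e`, so its total cost is infinite. Properness of `c` bounds the number of
actions of each requirement, which gives convergence. -/

/-! ### Computability of searches, arithmetic and list operations -/

/-- Unbounded search for a total computable predicate is computable. -/
theorem Computable.nat_find {α : Type*} [Primcodable α] {p : α → ℕ → Bool} (hp : Computable₂ p)
    (h : ∀ a, ∃ n, p a n = true) : Computable fun a => Nat.find (h a) := by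
  refine (Partrec.rfind (p := fun a n => Part.some (p a n)) hp.partrec₂).of_eq_tot fun a => ?_
  refine Nat.mem_rfind.2 ⟨?_, fun {m} hm => ?_⟩
  · simpa using (Nat.find_spec (h a)).symm
  · simpa using Nat.find_min (h a) hm

theorem exists_le_or (p : ℕ → Bool) (n : ℕ) : ∃ k, (decide (n ≤ k) || p k) = true := ⟨n, by simp⟩

/-- The least `k < n` with `p k`, or `n` if there is none. -/
def firstBelow (p : ℕ → Bool) (n : ℕ) : ℕ := Nat.find (exists_le_or p n)

theorem firstBelow_le (p : ℕ → Bool) (n : ℕ) : firstBelow p n ≤ n :=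
  Nat.find_min' _ (by simp)

theorem firstBelow_spec {p : ℕ → Bool} {n : ℕ} (h : firstBelow p n < n) :
    p (firstBelow p n) = true := by
  have := Nat.find_spec (exists_le_or p n)
  rw [Bool.or_eq_true, decide_eq_true_eq] at this
  exact this.resolve_left (not_le.2 h)

theorem firstBelow_le_of {p : ℕ → Bool} {n k : ℕ} (h : p k = true) : firstBelow p n ≤ k :=
  Nat.find_min' _ (by simp [h])

theorem Computable.firstBelow {α : Type*} [Primcodable α] {p : α → ℕ → Bool} {f : α → ℕ}
    (hp : Computable₂ p) (hf : Computable f) : Computable fun a => firstBelow (p a) (f a) := by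
  refine Computable.nat_find (p := fun a k => decide (f a ≤ k) || p a k) ?_
    fun a => exists_le_or (p a) (f a)
  exact Primrec.or.to_comp.comp
    (Primrec.nat_le.decide.to_comp.comp (hf.comp Computable.fst) Computable.snd) hp

theorem Computable.nat_add {α : Type*} [Primcodable α] {f g : α → ℕ} (hf : Computable f)
    (hg : Computable g) : Computable fun a => f a + g a := Primrec.nat_add.to_comp.comp hf hg

theorem Computable.nat_mul {α : Type*} [Primcodable α] {f g : α → ℕ} (hf : Computable f)
    (hg : Computable g) : Computable fun a => f a * g a := Primrec.nat_mul.to_comp.comp hf hg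

theorem Computable.nat_const_pow {α : Type*} [Primcodable α] {f : α → ℕ} (b : ℕ)
    (hf : Computable f) : Computable fun a => b ^ f a := by
  have : Primrec fun n : ℕ => b ^ n :=
    (Primrec.nat_rec₁ (f := fun _ r => r * b) 1
      (Primrec.nat_mul.comp Primrec.snd (Primrec.const b)).to₂).of_eq fun n => by
        induction n with
        | zero => rfl
        | succ n ih => rw [pow_succ, ← ih]
  exact this.to_comp.comp hf

theorem Computable.decide_le {α : Type*} [Primcodable α] {f g : α → ℕ} (hf : Computable f)
    (hg : Computable g) : Computable fun a => decide (f a ≤ g a) :=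
  Primrec.nat_le.decide.to_comp.comp hf hg

theorem Computable.decide_lt {α : Type*} [Primcodable α] {f g : α → ℕ} (hf : Computable f)
    (hg : Computable g) : Computable fun a => decide (f a < g a) :=
  Primrec.nat_lt.decide.to_comp.comp hf hg

theorem Computable.band {α : Type*} [Primcodable α] {f g : α → Bool} (hf : Computable f)
    (hg : Computable g) : Computable fun a => f a && g a := Primrec.and.to_comp.comp hf hg

theorem Computable.beq_bool {α : Type*} [Primcodable α] {f g : α → Bool} (hf : Computable f)
    (hg : Computable g) : Computable fun a => f a == g a :=
  (Primrec.dom_bool₂ fun a b => a == b).to_comp.comp hf hg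

theorem Computable.bnot {α : Type*} [Primcodable α] {f : α → Bool} (hf : Computable f) :
    Computable fun a => !f a := Primrec.not.to_comp.comp hf

theorem Primrec.decide_mem : Primrec₂ fun (x : ℕ) (l : List ℕ) => decide (x ∈ l) := by
  have h : PrimrecRel fun (l : List ℕ) (x : ℕ) => ∃ a ∈ l, a = x :=
    PrimrecRel.exists_mem_list Primrec.eq
  have h' : PrimrecRel fun (x : ℕ) (l : List ℕ) => x ∈ l :=
    h.swap.of_eq fun x l => by simp [Function.swap]
  exact h'.decide

theorem Computable.decide_mem {α : Type*} [Primcodable α] {f : α → ℕ} {g : α → List ℕ}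
    (hf : Computable f) (hg : Computable g) : Computable fun a => decide (f a ∈ g a) :=
  Primrec.decide_mem.to_comp.comp hf hg

/-- Setting the membership of `x` in the set listed by `l` to `b`. -/
def setMem (b : Bool) (x : ℕ) (l : List ℕ) : List ℕ := bif b then x :: l else l.filter (· ≠ x)

theorem mem_setMem {b : Bool} {x y : ℕ} {l : List ℕ} :
    y ∈ setMem b x l ↔ if y = x then b = true else y ∈ l := by
  cases b <;> by_cases h : y = x <;> simp [setMem, h]

theorem Primrec.setMem {α : Type*} [Primcodable α] {b : α → Bool} {f : α → ℕ} {g : α → List ℕ}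
    (hb : Primrec b) (hf : Primrec f) (hg : Primrec g) :
    Primrec fun a => setMem (b a) (f a) (g a) := by
  refine Primrec.cond hb (Primrec.list_cons.comp hf hg) ?_
  have h : PrimrecRel fun (y x : ℕ) => y ≠ x := Primrec.eq.not
  exact (PrimrecRel.listFilter h).comp hg hf

theorem Computable.setMem {α : Type*} [Primcodable α] {b : α → Bool} {f : α → ℕ} {g : α → List ℕ}
    (hb : Computable b) (hf : Computable f) (hg : Computable g) :
    Computable fun a => setMem (b a) (f a) (g a) :=
  Computable.comp (Primrec.setMem (α := Bool × ℕ × List ℕ) Primrec.fst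
    (Primrec.fst.comp Primrec.snd) (Primrec.snd.comp Primrec.snd)).to_comp
    (hb.pair (hf.pair hg))

/-! ### Enumeration of the opponents -/

/-- A uniformly computable enumeration of the partial computable sequences of lists; the value at
`t` of the sequence with index `e`, if its computation halts within `s` steps. -/
def guess (e t s : ℕ) : Option (List ℕ) :=
  (Nat.Partrec.Code.evaln s (Denumerable.ofNat Nat.Partrec.Code e.unpair.1) t).map
    (Denumerable.ofNat (List ℕ))

theorem guess_computable : Computable fun a : ℕ × ℕ × ℕ => guess a.1 a.2.1 a.2.2 := by
  have h1 : Primrec fun a : ℕ × ℕ × ℕ => Nat.Partrec.Code.evaln a.2.2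
      (Denumerable.ofNat Nat.Partrec.Code a.1.unpair.1) a.2.1 :=
    Nat.Partrec.Code.primrec_evaln.comp
      (((Primrec.snd.comp Primrec.snd).pair ((Primrec.ofNat Nat.Partrec.Code).comp
        (Primrec.fst.comp (Primrec.unpair.comp Primrec.fst)))).pair
        (Primrec.fst.comp Primrec.snd))
  exact (Primrec.option_map h1 ((Primrec.ofNat (List ℕ)).comp Primrec.snd).to₂).to_comp

/-- Padding: the second component of the pair is ignored by `guess`, so it can be used to make the
index large. The diagonalization needs this because requirement `e` alone forces only a finite
payment. -/
theorem exists_guess {L : ℕ → List ℕ} (hL : Computable L) (n : ℕ) :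
    ∃ e, n ≤ e ∧ (∀ t s v, guess e t s = some v → v = L t) ∧
      ∀ t, ∃ k, ∀ s, k ≤ s → guess e t s = some (L t) := by
  have hp : Nat.Partrec fun t => Part.some (Encodable.encode (L t)) :=
    Partrec.nat_iff.1 (Computable.encode.comp hL).partrec
  obtain ⟨C, hC⟩ := Nat.Partrec.Code.exists_code.1 hp
  refine ⟨Nat.pair (Encodable.encode C) n, Nat.right_le_pair _ _, fun t s v h => ?_, fun t => ?_⟩
  · simp only [guess, Nat.unpair_pair, Denumerable.ofNat_encode, Option.map_eq_some_iff] at h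
    obtain ⟨a, ha, rfl⟩ := h
    have := Nat.Partrec.Code.evaln_sound (Option.mem_def.2 ha)
    rw [hC] at this
    rw [Part.mem_some_iff.1 this, Denumerable.ofNat_encode]
  · have : Encodable.encode (L t) ∈ C.eval t := by rw [hC]; exact Part.mem_some _
    obtain ⟨k, hk⟩ := Nat.Partrec.Code.evaln_complete.1 this
    refine ⟨k, fun s hs => ?_⟩
    have := Option.mem_def.1 (Nat.Partrec.Code.evaln_mono hs hk)
    simp [guess, this]

/-! ### Monotonicity and computable comparison of costs -/

namespace CostFunction

theorem cost_mono {c : CostFunction} (hc : c.NondecreasingInStage) (x : ℕ) :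
    Monotone (c.cost x) := monotone_nat_of_le_succ (hc.2 x)

theorem ecost_mono {c : CostFunction} (hc : c.NondecreasingInStage) (x : ℕ) :
    Monotone (c.ecost x) := fun s t h => by
  simp only [ecost]
  exact_mod_cast cost_mono hc x h

theorem ecost_le_limit {c : CostFunction} (hc : c.NondecreasingInStage) (x s : ℕ) :
    c.ecost x s ≤ c.limit x := by
  rw [limit_eq_iSup c hc]
  exact le_iSup (c.ecost x) s

theorem natCast_mul_ecost (c : CostFunction) (N x s : ℕ) :
    (N : ℝ≥0∞) * c.ecost x s = (((N * c.cost x s : ℚ≥0) : ℝ≥0) : ℝ≥0∞) := by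
  simp [ecost]

theorem num_den_le_iff (a b : ℚ≥0) (M N : ℕ) :
    M * a.num * b.den ≤ N * b.num * a.den ↔ (M : ℚ≥0) * a ≤ N * b := by
  have ha : (0 : ℚ≥0) < a.den := by exact_mod_cast a.den_pos
  have hb : (0 : ℚ≥0) < b.den := by exact_mod_cast b.den_pos
  conv_rhs => rw [← NNRat.num_div_den a, ← NNRat.num_div_den b, ← mul_div_assoc, ← mul_div_assoc,
    div_le_div_iff₀ ha hb]
  norm_cast

/-- Computable comparison of multiples of the values of two cost functions. -/
def leBool (c d : CostFunction) (M N x s y t : ℕ) : Bool :=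
  decide (M * (c.cost x s).num * (d.cost y t).den ≤ N * (d.cost y t).num * (c.cost x s).den)

theorem leBool_iff {c d : CostFunction} {M N x s y t : ℕ} :
    leBool c d M N x s y t = true ↔ (M : ℝ≥0∞) * c.ecost x s ≤ N * d.ecost y t := by
  rw [leBool, decide_eq_true_eq, num_den_le_iff, natCast_mul_ecost, natCast_mul_ecost]
  norm_cast

theorem leBool_computable (c d : CostFunction) {α : Type*} [Primcodable α]
    {M N x s y t : α → ℕ} (hM : Computable M) (hN : Computable N) (hx : Computable x)
    (hs : Computable s) (hy : Computable y) (ht : Computable t) :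
    Computable fun a => leBool c d (M a) (N a) (x a) (s a) (y a) (t a) :=
  ((hM.nat_mul (c.computable_num.comp hx hs)).nat_mul (d.computable_den.comp hy ht)).decide_le
    ((hN.nat_mul (d.computable_num.comp hy ht)).nat_mul (c.computable_den.comp hx hs))

end CostFunction

/-! ### The cost of a single stage -/

theorem changeCost_eq {c : CostFunction} {A : ℕ → Finset ℕ} {x s : ℕ} (hx : x < s)
    (h : ¬(x ∈ A (s - 1) ↔ x ∈ A s)) (hlt : ∀ y < x, (y ∈ A (s - 1) ↔ y ∈ A s)) :
    changeCost c A s = c.ecost x s := by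
  have hex : ∃ x, x < s ∧ ¬(x ∈ A (s - 1) ↔ x ∈ A s) := ⟨x, hx, h⟩
  rw [changeCost, dif_pos hex]
  congr 1
  exact (Nat.find_eq_iff _).2 ⟨⟨hx, h⟩, fun y hy h' => h'.2 (hlt y hy)⟩

theorem changeCost_eq_zero {c : CostFunction} {A : ℕ → Finset ℕ} {s : ℕ}
    (h : ∀ x < s, (x ∈ A (s - 1) ↔ x ∈ A s)) : changeCost c A s = 0 := by
  rw [changeCost, dif_neg]
  push Not
  exact fun x hx => h x hx

theorem changeCost_le {c : CostFunction} {A : ℕ → Finset ℕ} {x s : ℕ}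
    (h : ∀ y < s, y ≠ x → (y ∈ A (s - 1) ↔ y ∈ A s)) : changeCost c A s ≤ c.ecost x s := by
  by_cases hx : x < s ∧ ¬(x ∈ A (s - 1) ↔ x ∈ A s)
  · exact (changeCost_eq hx.1 hx.2 fun y hy => h y (hy.trans hx.1) hy.ne).le
  · rw [changeCost_eq_zero]
    · exact zero_le
    · intro y hy
      by_cases hyx : y = x
      · subst hyx
        by_contra h'
        exact hx ⟨hy, h'⟩
      · exact h y hy hyx

/-- If membership of `x` differs at the stages `s ≤ t`, then it changes in between. -/
theorem exists_change {A : ℕ → Finset ℕ} {x s t : ℕ} (hst : s ≤ t) (h : ¬(x ∈ A s ↔ x ∈ A t)) :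
    ∃ u, s ≤ u ∧ u < t ∧ ¬(x ∈ A u ↔ x ∈ A (u + 1)) := by
  induction t, hst using Nat.le_induction with
  | base => exact absurd Iff.rfl h
  | succ t hst ih =>
    by_cases hx : x ∈ A s ↔ x ∈ A t
    · exact ⟨t, hst, t.lt_succ_self, fun h' => h (hx.trans h')⟩
    · obtain ⟨u, h1, h2, h3⟩ := ih hx
      exact ⟨u, h1, h2.trans t.lt_succ_self, h3⟩

/-! ### Speeding up an approximation: the sufficient condition -/

/-- Stage `t` is large enough for `N * c(x, t)` to exceed `d(x, n)` for all `x < n`. -/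
theorem exists_stage {c d : CostFunction} (hc : c.NondecreasingInStage)
    (hd : d.NondecreasingInStage) {N : ℕ} (hN : ∀ x, (N : ℝ≥0∞) * c.limit x > d.limit x)
    (n a : ℕ) : ∃ t, a < t ∧ n ≤ t ∧ ∀ x < n, d.ecost x n ≤ N * c.ecost x t := by
  have h : ∀ x, ∃ t, d.ecost x n ≤ N * c.ecost x t := fun x => by
    have h1 : d.ecost x n < N * c.limit x := (CostFunction.ecost_le_limit hd x n).trans_lt (hN x)
    rw [CostFunction.limit_eq_iSup c hc, ENNReal.mul_iSup, lt_iSup_iff] at h1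
    obtain ⟨t, ht⟩ := h1
    exact ⟨t, ht.le⟩
  choose t ht using h
  -- The sum dominates each of the finitely many stages `t x`, and `c` is nondecreasing in the
  -- stage.
  refine ⟨a + 1 + n + ∑ x ∈ Finset.range n, t x, by omega, by omega, fun x hx => ?_⟩
  refine (ht x).trans (mul_le_mul_right (CostFunction.ecost_mono hc x ?_) _)
  have := Finset.single_le_sum (f := t) (fun _ _ => Nat.zero_le _) (Finset.mem_range.2 hx)
  omega

/-- A computable sequence of stages at which `c` has caught up with `d`. -/
theorem exists_speedup {c d : CostFunction} (hc : c.NondecreasingInStage)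
    (hd : d.NondecreasingInStage) {N : ℕ} (hN : ∀ x, (N : ℝ≥0∞) * c.limit x > d.limit x) :
    ∃ f : ℕ → ℕ, Computable f ∧ StrictMono f ∧ (∀ w, 2 * w + 2 ≤ f w) ∧
      ∀ w, ∀ x < 2 * w + 2, d.ecost x (2 * w + 2) ≤ N * c.ecost x (f w) := by
  let q : ℕ × ℕ → ℕ → ℕ → Bool := fun a t x => !(CostFunction.leBool d c 1 N x a.1 x t)
  have hq : ∀ a t x, q a t x = false ↔ d.ecost x a.1 ≤ N * c.ecost x t := by
    intro a t x
    simp only [q, Bool.not_eq_false', CostFunction.leBool_iff, Nat.cast_one, one_mul]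
  -- Bounded quantification by search: the least failure is at least `a.1` exactly when there is
  -- none below `a.1`.
  let p : ℕ × ℕ → ℕ → Bool := fun a t =>
    decide (a.2 < t) && (decide (a.1 ≤ t) && decide (a.1 ≤ firstBelow (q a t) a.1))
  have hpc : Computable₂ p := by
    have h1 : Computable fun z : (ℕ × ℕ) × ℕ => z.1.1 := Computable.fst.comp Computable.fst
    have h2 : Computable fun z : (ℕ × ℕ) × ℕ => z.1.2 := Computable.snd.comp Computable.fst
    have h3 : Computable fun z : (ℕ × ℕ) × ℕ => z.2 := Computable.snd
    refine (h2.decide_lt h3).band ((h1.decide_le h3).band (h1.decide_le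
      (Computable.firstBelow ?_ h1)))
    have g1 : Computable fun z : ((ℕ × ℕ) × ℕ) × ℕ => z.1.1.1 := h1.comp Computable.fst
    have g2 : Computable fun z : ((ℕ × ℕ) × ℕ) × ℕ => z.1.2 := h3.comp Computable.fst
    have g3 : Computable fun z : ((ℕ × ℕ) × ℕ) × ℕ => z.2 := Computable.snd
    exact (CostFunction.leBool_computable d c (Computable.const 1) (Computable.const N)
      g3 g1 g3 g2).bnot
  have hp : ∀ a t, p a t = true ↔ a.2 < t ∧ a.1 ≤ t ∧
      ∀ x < a.1, d.ecost x a.1 ≤ N * c.ecost x t := by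
    intro a t
    simp only [p, Bool.and_eq_true, decide_eq_true_eq]
    refine and_congr_right fun _ => and_congr_right fun _ => ⟨fun h x hx => ?_, fun h => ?_⟩
    · rw [← hq, ← Bool.not_eq_true]
      intro hcon
      exact absurd (firstBelow_le_of (n := a.1) hcon) (by omega)
    · by_contra! hlt
      have := firstBelow_spec hlt
      rw [(hq _ _ _).2 (h _ hlt)] at this
      exact Bool.false_ne_true this
  have hex : ∀ a, ∃ t, p a t = true := fun a => by
    obtain ⟨t, ht⟩ := exists_stage hc hd hN a.1 a.2
    exact ⟨t, (hp a t).2 ht⟩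
  let g : ℕ × ℕ → ℕ := fun a => Nat.find (hex a)
  have hgc : Computable g := Computable.nat_find hpc hex
  have hg : ∀ a, a.2 < g a ∧ a.1 ≤ g a ∧ ∀ x < a.1, d.ecost x a.1 ≤ N * c.ecost x (g a) :=
    fun a => (hp _ _).1 (Nat.find_spec (hex a))
  -- The second argument of `g` is the previous stage, which makes `f` strictly increasing.
  let f : ℕ → ℕ := fun n => Nat.rec (g (2, 0)) (fun w r => g (2 * (w + 1) + 2, r)) n
  have hf : ∀ w, f w = g (2 * w + 2, if w = 0 then 0 else f (w - 1)) := by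
    intro w
    cases w <;> simp [f]
  refine ⟨f, ?_, strictMono_nat_of_lt_succ fun w => ?_, fun w => ?_, fun w x hx => ?_⟩
  · have h1 : Computable fun z : ℕ × ℕ × ℕ => z.2.1 := Computable.fst.comp Computable.snd
    have h2 : Computable fun z : ℕ × ℕ × ℕ => z.2.2 := Computable.snd.comp Computable.snd
    have h3 : Computable₂ fun (_ : ℕ) (z : ℕ × ℕ) => g (2 * (z.1 + 1) + 2, z.2) :=
      Computable.comp hgc (((((Computable.const 2).nat_mul (h1.nat_add
        (Computable.const 1))).nat_add (Computable.const 2))).pair h2)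
    exact Computable.nat_rec Computable.id (Computable.const (g (2, 0))) h3
  · exact (hg (2 * (w + 1) + 2, f w)).1
  · rw [hf]; exact (hg (2 * w + 2, if w = 0 then 0 else f (w - 1))).2.1
  · have := (hg (2 * w + 2, if w = 0 then 0 else f (w - 1))).2.2 x hx
    rwa [hf]

/-- The least `y < n` at which the sequence of lists `L` changes between the stages `a` and `b`,
or `n` if there is none. -/
def firstChange (L : ℕ → List ℕ) (a b n : ℕ) : ℕ :=
  firstBelow (fun y => decide (firstBelow (fun u => decide (a ≤ u) &&
    !(decide (y ∈ L u) == decide (y ∈ L (u + 1)))) b < b)) n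

theorem firstChange_computable {L : ℕ → List ℕ} (hL : Computable L) {α : Type*} [Primcodable α]
    {a b n : α → ℕ} (ha : Computable a) (hb : Computable b) (hn : Computable n) :
    Computable fun z => firstChange L (a z) (b z) (n z) := by
  refine Computable.firstBelow (Computable.decide_lt (Computable.firstBelow ?_
    (hb.comp Computable.fst)) (hb.comp Computable.fst)) hn
  have h1 : Computable fun z : (α × ℕ) × ℕ => a z.1.1 :=
    ha.comp (Computable.fst.comp Computable.fst)
  have h2 : Computable fun z : (α × ℕ) × ℕ => z.1.2 := Computable.snd.comp Computable.fst
  have h3 : Computable fun z : (α × ℕ) × ℕ => z.2 := Computable.snd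
  exact (h1.decide_le h3).band (((h2.decide_mem (hL.comp h3)).beq_bool
    (h2.decide_mem (hL.comp (h3.nat_add (Computable.const 1))))).bnot)

theorem exists_of_firstChange_lt {L : ℕ → List ℕ} {a b n : ℕ} (h : firstChange L a b n < n) :
    ∃ u, a ≤ u ∧ u < b ∧
      ¬(firstChange L a b n ∈ L u ↔ firstChange L a b n ∈ L (u + 1)) := by
  have h1 := firstBelow_spec h
  rw [decide_eq_true_eq] at h1
  have h2 := firstBelow_spec h1
  rw [Bool.and_eq_true, decide_eq_true_eq, Bool.not_eq_true', beq_eq_false_iff_ne, ne_eq,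
    decide_eq_decide] at h2
  exact ⟨_, h2.1, h1, h2.2⟩

theorem mem_iff_of_lt_firstChange {L : ℕ → List ℕ} {a b n y : ℕ} (h : y < firstChange L a b n)
    {u : ℕ} (hu : a ≤ u) (hub : u < b) : y ∈ L u ↔ y ∈ L (u + 1) := by
  by_contra hcon
  refine absurd (firstBelow_le_of (n := n) (p := fun y => decide (firstBelow (fun u =>
    decide (a ≤ u) && !(decide (y ∈ L u) == decide (y ∈ L (u + 1)))) b < b)) (k := y) ?_)
    (not_le.2 h)
  rw [decide_eq_true_eq]
  refine lt_of_le_of_lt (firstBelow_le_of (k := u) ?_) hub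
  simpa [hu] using hcon

theorem mem_iff_mem_of_lt_firstChange {L : ℕ → List ℕ} {a b n y : ℕ}
    (h : y < firstChange L a b n) (hab : a ≤ b) : y ∈ L a ↔ y ∈ L b := by
  by_contra hcon
  obtain ⟨u, h1, h2, h3⟩ := exists_change (A := fun s => (L s).toFinset) hab (x := y)
    (by simpa using hcon)
  exact h3 (by simpa using mem_iff_of_lt_firstChange h h1 h2)

/-- The approximation `L` along the stages `f 0 < f 1 < …`. Between `f w` and `f (w + 1)` a further
stage is inserted at which the membership of the least element changed in the meantime is
flipped. -/
def speedup (L : ℕ → List ℕ) (f : ℕ → ℕ) (s : ℕ) : List ℕ :=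
  let y := firstChange L (f (s / 2)) (f (s / 2 + 1)) (2 * (s / 2) + 2)
  bif decide (s % 2 ≤ 0) then L (f (s / 2))
  else setMem (!decide (y ∈ L (f (s / 2)))) y (L (f (s / 2 + 1)))

theorem speedup_computable {L : ℕ → List ℕ} {f : ℕ → ℕ} (hL : Computable L) (hf : Computable f) :
    Computable (speedup L f) := by
  have hdiv : Computable fun s : ℕ => s / 2 :=
    (Primrec.nat_div.comp Primrec.id (Primrec.const 2)).to_comp
  have hmod : Computable fun s : ℕ => s % 2 :=
    (Primrec.nat_mod.comp Primrec.id (Primrec.const 2)).to_comp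
  have h1 : Computable fun s : ℕ => f (s / 2) := hf.comp hdiv
  have h2 : Computable fun s : ℕ => f (s / 2 + 1) := hf.comp (hdiv.nat_add (Computable.const 1))
  have hy := firstChange_computable hL h1 h2
    (((Computable.const 2).nat_mul hdiv).nat_add (Computable.const 2))
  exact Computable.cond (hmod.decide_le (Computable.const 0)) (hL.comp h1)
    (Computable.setMem ((hy.decide_mem (hL.comp h1)).bnot) hy (hL.comp h2))

theorem speedup_even (L : ℕ → List ℕ) (f : ℕ → ℕ) (w : ℕ) : speedup L f (2 * w) = L (f w) := by
  simp [speedup]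

theorem mem_speedup_odd {L : ℕ → List ℕ} {f : ℕ → ℕ} {w z : ℕ} :
    z ∈ speedup L f (2 * w + 1) ↔ if z = firstChange L (f w) (f (w + 1)) (2 * w + 2)
      then z ∉ L (f w) else z ∈ L (f (w + 1)) := by
  have h1 : (2 * w + 1) / 2 = w := by omega
  have h2 : (2 * w + 1) % 2 = 1 := by omega
  simp only [speedup, h1, h2, nonpos_iff_eq_zero, one_ne_zero, decide_false, cond_false,
    mem_setMem, Bool.not_eq_true', decide_eq_false_iff_not]
  split_ifs with h
  · rw [h]
  · rfl

/-- Nothing below `y` moves anywhere in the block, so the original change of `y` has cost exactly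
`c` at `y`, while neither new stage changes anything below `y`. -/
theorem speedup_changeCost_le {c d : CostFunction} (hc : c.NondecreasingInStage)
    (hd : d.NondecreasingInStage) {N : ℕ} {f : ℕ → ℕ} (hf : StrictMono f)
    (hf2 : ∀ w, 2 * w + 2 ≤ f w)
    (hfc : ∀ w, ∀ x < 2 * w + 2, d.ecost x (2 * w + 2) ≤ N * c.ecost x (f w))
    {L : ℕ → List ℕ} {A : ℕ → Finset ℕ} (hLA : ∀ s, (L s).toFinset = A s) (w : ℕ) {s : ℕ}
    (hs : s = 2 * w ∨ s = 2 * w + 1) :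
    changeCost d (fun s => (speedup L f s).toFinset) (s + 1) ≤
      N * ∑ u ∈ Finset.Ico (f w) (f (w + 1)), changeCost c A (u + 1) := by
  set y := firstChange L (f w) (f (w + 1)) (2 * w + 2) with hy
  have hww : f w ≤ f (w + 1) := hf.monotone w.le_succ
  have hlow : ∀ z < y, (z ∈ speedup L f (s + 1 - 1) ↔ z ∈ speedup L f (s + 1)) := by
    intro z hz
    have hz' := mem_iff_mem_of_lt_firstChange hz hww
    rcases hs with rfl | rfl
    · rw [Nat.add_sub_cancel, speedup_even, mem_speedup_odd, if_neg (hz.trans_eq hy).ne, hz']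
    · rw [Nat.add_sub_cancel, mem_speedup_odd, if_neg (hz.trans_eq hy).ne,
        show 2 * w + 1 + 1 = 2 * (w + 1) by ring, speedup_even]
  by_cases hys : y < s + 1
  · have hy2 : y < 2 * w + 2 := by omega
    obtain ⟨u, hu1, hu2, hu3⟩ := exists_of_firstChange_lt (hy ▸ hy2)
    have hcA : changeCost c A (u + 1) = c.ecost y (u + 1) := by
      refine changeCost_eq (by have := hf2 w; omega) ?_ fun z hz => ?_
      · simpa [← hLA] using hu3
      · simpa [← hLA] using mem_iff_of_lt_firstChange hz hu1 hu2
    have hle : changeCost d (fun s => (speedup L f s).toFinset) (s + 1) ≤ d.ecost y (s + 1) := by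
      by_cases hch : y ∈ speedup L f (s + 1 - 1) ↔ y ∈ speedup L f (s + 1)
      · have hall : ∀ z < s + 1, (z ∈ (speedup L f (s + 1 - 1)).toFinset ↔
            z ∈ (speedup L f (s + 1)).toFinset) := by
          intro z _
          simp only [List.mem_toFinset]
          rcases lt_trichotomy z y with h | rfl | h
          · exact hlow z h
          · exact hch
          · rcases hs with rfl | rfl
            -- The inserted stage always reverses `y`, so the first of the two steps cannot leave it
            -- unchanged.
            · exfalso
              rw [Nat.add_sub_cancel, speedup_even, mem_speedup_odd, if_pos hy] at hch
              tauto
            · rw [Nat.add_sub_cancel, mem_speedup_odd, if_neg (hy ▸ h.ne'),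
                show 2 * w + 1 + 1 = 2 * (w + 1) by ring, speedup_even]
        rw [changeCost_eq_zero hall]
        exact zero_le
      · exact (changeCost_eq hys (by simpa using hch) (by simpa using hlow)).le
    calc _ ≤ d.ecost y (s + 1) := hle
      _ ≤ d.ecost y (2 * w + 2) := CostFunction.ecost_mono hd y (by omega)
      _ ≤ N * c.ecost y (f w) := hfc w y hy2
      _ ≤ N * c.ecost y (u + 1) := mul_le_mul_right (CostFunction.ecost_mono hc y (by omega)) _
      _ = N * changeCost c A (u + 1) := by rw [hcA]
      _ ≤ _ := mul_le_mul_right (Finset.single_le_sum (f := fun u => changeCost c A (u + 1))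
          (fun _ _ => zero_le) (Finset.mem_Ico.2 ⟨hu1, hu2⟩)) _
  -- A flip at `y ≥ s + 1`, including the default value `2 * w + 2`, is free: only elements below
  -- the stage are charged.
  · rw [changeCost_eq_zero]
    · exact zero_le
    · intro z hz
      simpa using hlow z (by omega)

/-- Two new stages are charged to each block of old stages, whence the factor `2 * N`. -/
theorem implies_of_forall_limit_lt {c d : CostFunction} (hc : c.NondecreasingInStage)
    (hd : d.NondecreasingInStage) {N : ℕ} (hN : ∀ x, (N : ℝ≥0∞) * c.limit x > d.limit x) :
    c.Implies d := by
  rintro X ⟨A, ⟨⟨L, hL, hLA⟩, hAX⟩, hA⟩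
  obtain ⟨f, hfc, hfm, hf2, hf⟩ := exists_speedup hc hd hN
  refine ⟨fun s => (speedup L f s).toFinset,
    ⟨⟨speedup L f, speedup_computable hL hfc, fun _ => rfl⟩, fun x => ?_⟩, ?_⟩
  · obtain ⟨S, hS⟩ := eventually_atTop.1 (hAX x)
    have hS' : ∀ s, S ≤ s → (x ∈ L s ↔ x ∈ X) := fun s hs => by
      rw [← hS s hs, ← hLA, List.mem_toFinset]
    -- This forces `f w ≥ S` and `x < 2 * w + 2`, so `x` no longer changes in the block and is not
    -- the flipped element.
    filter_upwards [eventually_ge_atTop (2 * S + 2 * x + 2)] with s hs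
    rw [List.mem_toFinset]
    obtain ⟨w, rfl | rfl⟩ : ∃ w, s = 2 * w ∨ s = 2 * w + 1 := ⟨s / 2, by omega⟩
    · rw [speedup_even]
      exact hS' _ (by have := hf2 w; omega)
    · rw [mem_speedup_odd, if_neg]
      · exact hS' _ (by have := hf2 (w + 1); omega)
      · intro hx
        obtain ⟨u, h1, h2, h3⟩ := exists_of_firstChange_lt (L := L) (a := f w) (b := f (w + 1))
          (n := 2 * w + 2) (by omega)
        rw [← hx] at h3
        have := hf2 w
        exact h3 ((hS' u (by omega)).trans (hS' (u + 1) (by omega)).symm)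
  · have hsum : ∀ w, ∑ s ∈ Finset.range (2 * w),
        changeCost d (fun s => (speedup L f s).toFinset) (s + 1) ≤
        2 * N * ∑ u ∈ Finset.range (f w), changeCost c A (u + 1) := by
      intro w
      induction w with
      | zero => simp
      | succ w ih =>
        rw [← Finset.sum_range_add_sum_Ico _ (hfm.monotone w.le_succ),
          show 2 * (w + 1) = 2 * w + 1 + 1 by ring, Finset.sum_range_succ, Finset.sum_range_succ,
          add_assoc, mul_add]
        refine add_le_add ih ?_
        rw [mul_assoc, two_mul (_ * _ : ℝ≥0∞)]
        exact add_le_add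
          (speedup_changeCost_le hc hd hfm hf2 hf hLA w (Or.inl rfl))
          (speedup_changeCost_le hc hd hfm hf2 hf hLA w (Or.inr rfl))
    have hle : totalCost d (fun s => (speedup L f s).toFinset) ≤ 2 * N * totalCost c A := by
      rw [totalCost, ENNReal.tsum_eq_iSup_nat]
      refine iSup_le fun n => ?_
      calc _ ≤ ∑ s ∈ Finset.range (2 * n),
            changeCost d (fun s => (speedup L f s).toFinset) (s + 1) :=
          Finset.sum_le_sum_of_subset (Finset.range_subset_range.2 (by omega))
        _ ≤ _ := hsum n
        _ ≤ _ := mul_le_mul_right (ENNReal.sum_le_tsum _) _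
    exact hle.trans_lt (ENNReal.mul_lt_top
      (ENNReal.mul_lt_top (by simp) (ENNReal.natCast_lt_top N)) hA)

/-! ### The finite injury construction -/

/-- An action `(s, e, x, t, p, q)`: at stage `s` the requirement `e` flips the membership of `x`,
using the approximation of its opponent at `t`, at the cost `p / q`. -/
abbrev FlipAction := ℕ × ℕ × ℕ × ℕ × ℕ × ℕ

/-- The state `(r, b, x, p, q)` of a requirement: the restraint `r`, the lower bound `b` on the next
stage of the opponent to be used, the element `x` flipped last, and the cost `p / q` incurred since
the restraint was imposed. -/
abbrev ReqState := ℕ × ℕ × ℕ × ℕ × ℕ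

/-- The effect of an action on the state of the requirement `e`. -/
def ReqState.update (e : ℕ) (a : FlipAction) (I : ReqState) : ReqState :=
  -- Injury: the new restraint exceeds the stage, hence every element flipped so far, and the
  -- allowance restarts at `0 / 1`. In the next case the cost of the action is added as a fraction,
  -- without reduction.
  if a.2.1 < e then (a.1 + 1, 0, 0, 0, 1)
  else if a.2.1 = e then (I.1, a.2.2.2.1 + 1, a.2.2.1,
    I.2.2.2.1 * a.2.2.2.2.2 + a.2.2.2.2.1 * I.2.2.2.2, I.2.2.2.2 * a.2.2.2.2.2)
  else I

/-- The state of the requirement `e` after a list of actions, the latest one first. -/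
def reqState (e : ℕ) (H : List FlipAction) : ReqState :=
  H.foldr (ReqState.update e) (0, 0, 0, 0, 1)

/-- The set obtained by a list of actions. -/
def flipped (H : List FlipAction) : List ℕ :=
  H.foldr (fun a l => setMem (!decide (a.2.2.1 ∈ l)) a.2.2.1 l) []

theorem reqState_primrec : Primrec₂ reqState := by
  refine Primrec.list_foldr (f := fun z : ℕ × List FlipAction => z.2) (g := fun _ => (0, 0, 0, 0, 1))
    (h := fun z w => ReqState.update z.1 w.1 w.2) Primrec.snd (Primrec.const _) ?_
  have e : Primrec fun z : (ℕ × List FlipAction) × FlipAction × ReqState => z.1.1 :=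
    Primrec.fst.comp Primrec.fst
  have a : Primrec fun z : (ℕ × List FlipAction) × FlipAction × ReqState => z.2.1 :=
    Primrec.fst.comp Primrec.snd
  have I : Primrec fun z : (ℕ × List FlipAction) × FlipAction × ReqState => z.2.2 :=
    Primrec.snd.comp Primrec.snd
  have a1 := Primrec.fst.comp a
  have a2 := Primrec.snd.comp a
  have ae := Primrec.fst.comp a2
  have a3 := Primrec.snd.comp a2
  have ax := Primrec.fst.comp a3
  have a4 := Primrec.snd.comp a3
  have at' := Primrec.fst.comp a4
  have a5 := Primrec.snd.comp a4
  have ap := Primrec.fst.comp a5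
  have aq := Primrec.snd.comp a5
  have I1 := Primrec.fst.comp I
  have I4 := Primrec.snd.comp (Primrec.snd.comp (Primrec.snd.comp I))
  have Ip := Primrec.fst.comp I4
  have Iq := Primrec.snd.comp I4
  refine Primrec.ite (Primrec.nat_lt.comp ae e)
    ((Primrec.succ.comp a1).pair (Primrec.const (0, 0, 0, 1)))
    (Primrec.ite (Primrec.eq.comp ae e) (I1.pair ((Primrec.succ.comp at').pair (ax.pair
      ((Primrec.nat_add.comp (Primrec.nat_mul.comp Ip aq) (Primrec.nat_mul.comp ap Iq)).pair
        (Primrec.nat_mul.comp Iq aq))))) I)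

theorem flipped_primrec : Primrec flipped := by
  refine Primrec.list_foldr (f := fun z : List FlipAction => z) (g := fun _ => ([] : List ℕ))
    (h := fun _ w => setMem (!decide (w.1.2.2.1 ∈ w.2)) w.1.2.2.1 w.2) Primrec.id
    (Primrec.const _) ?_
  have x : Primrec fun z : List FlipAction × FlipAction × List ℕ => z.2.1.2.2.1 :=
    Primrec.fst.comp (Primrec.snd.comp (Primrec.snd.comp (Primrec.fst.comp Primrec.snd)))
  have l : Primrec fun z : List FlipAction × FlipAction × List ℕ => z.2.2 :=
    Primrec.snd.comp Primrec.snd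
  exact Primrec.setMem (Primrec.not.comp (Primrec.decide_mem.comp x l)) x l

/-- The element `x` is cheap to flip at stage `s + 1` with respect to `c`, and more expensive by the
factor `4 ^ m` for an opponent with respect to `d` at its stage `t`. -/
def suitable (c d : CostFunction) (m r s t x : ℕ) : Bool :=
  decide (r ≤ x) && (decide (2 ^ m * (c.cost x (s + 1)).num ≤ (c.cost x (s + 1)).den) &&
    CostFunction.leBool c d (4 ^ m) 1 x (s + 1) x t)

/-- The test whether a requirement in the state `I` acts at stage `s` by flipping the element `x` of
the set listed by `A`, when its opponent has the value `l` at its stage `t`. -/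
def mayAct (m t x : ℕ) (I : ReqState) (A l : List ℕ) : Bool :=
  decide (I.2.1 ≤ t) && (decide (x ≤ t) && ((decide (x ∈ l) == decide (x ∈ A)) &&
    ((decide (I.2.2.1 ∈ l) == decide (I.2.2.1 ∈ A)) &&
      -- The requirement continues while the amount spent is below `2 * 2^-m`.
      decide (I.2.2.2.1 * 2 ^ m < 2 * I.2.2.2.2))))

/-- The element considered at stage `s` by the requirement in charge. -/
def candidate (c d : CostFunction) (s : ℕ) (H : List FlipAction) : ℕ :=
  let e := s.unpair.1
  let t := s.unpair.2.unpair.1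
  let r := (reqState e H).1
  -- The value `t + 1` signals that no element is suitable; the test `x ≤ t` in `mayAct` rejects it.
  firstBelow (suitable c d (e + r) r s t) (t + 1)

/-- One stage of the construction. -/
def stageStep (c d : CostFunction) (s : ℕ) (H : List FlipAction) : List FlipAction :=
  -- The last component of the decoded stage is a dummy, so each pair `(e, t)` is considered at
  -- infinitely many stages.
  let e := s.unpair.1
  let t := s.unpair.2.unpair.1
  let x := candidate c d s H
  (guess e t s).elim H fun l =>
    bif mayAct (e + (reqState e H).1) t x (reqState e H) (flipped H) l
    then (s, e, x, t, (c.cost x (s + 1)).num, (c.cost x (s + 1)).den) :: H else H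

/-- The list of actions before stage `s`, the latest one first. -/
def history (c d : CostFunction) (s : ℕ) : List FlipAction :=
  Nat.rec [] (fun s H => stageStep c d s H) s

theorem candidate_computable (c d : CostFunction) : Computable₂ (candidate c d) := by
  have s : Computable fun z : ℕ × List FlipAction => z.1 := Computable.fst
  have e := Computable.fst.comp (Computable.unpair.comp s)
  have t := Computable.fst.comp (Computable.unpair.comp
    (Computable.snd.comp (Computable.unpair.comp s)))
  have r : Computable fun z : ℕ × List FlipAction => (reqState z.1.unpair.1 z.2).1 :=
    Computable.fst.comp (reqState_primrec.to_comp.comp e Computable.snd)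
  refine Computable.firstBelow ?_ (t.nat_add (Computable.const 1))
  have x : Computable fun z : (ℕ × List FlipAction) × ℕ => z.2 := Computable.snd
  have s' := s.comp (Computable.fst (β := ℕ))
  have s1 := s'.nat_add (Computable.const 1)
  have r' := r.comp (Computable.fst (β := ℕ))
  have m := (e.comp (Computable.fst (β := ℕ))).nat_add r'
  have t' := t.comp (Computable.fst (β := ℕ))
  exact (r'.decide_le x).band (((((Computable.nat_const_pow 2 m).nat_mul
    (c.computable_num.comp x s1)).decide_le (c.computable_den.comp x s1))).band
    (CostFunction.leBool_computable c d (Computable.nat_const_pow 4 m) (Computable.const 1)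
      x s1 x t'))

theorem stageStep_computable (c d : CostFunction) : Computable₂ (stageStep c d) := by
  have s : Computable fun z : ℕ × List FlipAction => z.1 := Computable.fst
  have e := Computable.fst.comp (Computable.unpair.comp s)
  have t := Computable.fst.comp (Computable.unpair.comp
    (Computable.snd.comp (Computable.unpair.comp s)))
  have H : Computable fun z : ℕ × List FlipAction => z.2 := Computable.snd
  have I := reqState_primrec.to_comp.comp e H
  have x : Computable fun z : ℕ × List FlipAction => candidate c d z.1 z.2 := candidate_computable c d
  have A := flipped_primrec.to_comp.comp H
  have g := guess_computable.comp (e.pair (t.pair s))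
  have w := Computable.fst (α := ℕ × List FlipAction) (β := List ℕ)
  have s1 := s.nat_add (Computable.const 1)
  have l := Computable.snd (α := ℕ × List FlipAction) (β := List ℕ)
  have m := e.nat_add (Computable.fst.comp I)
  have I3 := Computable.snd.comp (Computable.snd.comp I)
  have I4 := Computable.snd.comp I3
  have hact := (((Computable.fst.comp (Computable.snd.comp I)).decide_le t).comp w).band
    (((x.decide_le t).comp w).band ((((x.comp w).decide_mem l).beq_bool
      ((x.decide_mem A).comp w)).band (((((Computable.fst.comp I3).comp w).decide_mem l).beq_bool
        (((Computable.fst.comp I3).decide_mem A).comp w)).band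
      ((((Computable.fst.comp I4).nat_mul (Computable.nat_const_pow 2 m)).decide_lt
        ((Computable.const 2).nat_mul (Computable.snd.comp I4))).comp w))))
  have hnew := Computable.list_cons.comp (s.pair (e.pair (x.pair (t.pair
    ((c.computable_num.comp x s1).pair (c.computable_den.comp x s1)))))) H
  refine (Computable.option_casesOn g H
    (Computable.cond hact (hnew.comp w) (H.comp w)).to₂).of_eq fun z => ?_
  rcases z with ⟨s, H⟩
  simp only [stageStep]
  cases guess s.unpair.1 s.unpair.2.unpair.1 s <;> rfl

theorem history_computable (c d : CostFunction) : Computable (history c d) := by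
  have h : Computable₂ fun (_ : ℕ) (z : ℕ × List FlipAction) => stageStep c d z.1 z.2 :=
    Computable.comp (stageStep_computable c d) (Computable.snd (α := ℕ))
  exact Computable.nat_rec Computable.id (Computable.const []) h

/-! ### Quantities and properties read off from the construction -/

/-- The restraint imposed on the requirement `e` at stage `s`. -/
def restraint (c d : CostFunction) (e s : ℕ) : ℕ := (reqState e (history c d s)).1

/-- The lower bound on the next stage of its opponent used by the requirement `e`. -/
def nextBound (c d : CostFunction) (e s : ℕ) : ℕ := (reqState e (history c d s)).2.1

/-- The element flipped last by the requirement `e`. -/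
def lastPoint (c d : CostFunction) (e s : ℕ) : ℕ := (reqState e (history c d s)).2.2.1

/-- The cost incurred by the requirement `e` since the current restraint was imposed. -/
noncomputable def spent (c d : CostFunction) (e s : ℕ) : ℝ≥0∞ :=
  ((((reqState e (history c d s)).2.2.2.1 / (reqState e (history c d s)).2.2.2.2 : ℚ≥0) : ℝ≥0) :
    ℝ≥0∞)

/-- The stages of the constructed approximation. -/
def approx (c d : CostFunction) (s : ℕ) : List ℕ := flipped (history c d s)

/-- At stage `s` the requirement `e` flips `x`, its opponent being considered at `t`. -/
structure ActsAt (c d : CostFunction) (s e x t : ℕ) : Prop where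
  stage_le : t ≤ s
  exists_guess : ∃ l, guess e t s = some l ∧ (x ∈ l ↔ x ∈ approx c d s) ∧
    (lastPoint c d e s ∈ l ↔ lastPoint c d e s ∈ approx c d s)
  bound_le : nextBound c d e s ≤ t
  point_le : x ≤ t
  restraint_le : restraint c d e s ≤ x
  cheap : 2 ^ (e + restraint c d e s) * c.ecost x (s + 1) ≤ 1
  gain : 4 ^ (e + restraint c d e s) * c.ecost x (s + 1) ≤ d.ecost x t
  least : ∀ y < x, suitable c d (e + restraint c d e s) (restraint c d e s) s t y = false
  spent_lt : 2 ^ (e + restraint c d e s) * spent c d e s < 2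
  history_eq : history c d (s + 1) =
    (s, e, x, t, (c.cost x (s + 1)).num, (c.cost x (s + 1)).den) :: history c d s

theorem two_pow_mul_ecost_le_one_iff {c : CostFunction} {k x s : ℕ} :
    2 ^ k * (c.cost x s).num ≤ (c.cost x s).den ↔ (2 : ℝ≥0∞) ^ k * c.ecost x s ≤ 1 := by
  have h1 : (0 : ℚ≥0) < (c.cost x s).den := by exact_mod_cast (c.cost x s).den_pos
  have h2 : (2 : ℝ≥0∞) ^ k * c.ecost x s = (((2 ^ k * c.cost x s : ℚ≥0) : ℝ≥0) : ℝ≥0∞) := by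
    simp [CostFunction.ecost]
  rw [h2, ← ENNReal.coe_one, ENNReal.coe_le_coe, ← NNRat.cast_one, NNRat.cast_le]
  conv_rhs => rw [← NNRat.num_div_den (c.cost x s), ← mul_div_assoc, div_le_one h1]
  norm_cast

theorem suitable_iff {c d : CostFunction} {m r s t x : ℕ} : suitable c d m r s t x = true ↔
    r ≤ x ∧ 2 ^ m * c.ecost x (s + 1) ≤ 1 ∧ 4 ^ m * c.ecost x (s + 1) ≤ d.ecost x t := by
  simp only [suitable, Bool.and_eq_true, decide_eq_true_eq, CostFunction.leBool_iff,
    two_pow_mul_ecost_le_one_iff]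
  norm_num

theorem history_zero (c d : CostFunction) : history c d 0 = [] := rfl

theorem history_succ (c d : CostFunction) (s : ℕ) :
    history c d (s + 1) = stageStep c d s (history c d s) := rfl

theorem entry_den_pos (c d : CostFunction) (s : ℕ) :
    ∀ a ∈ history c d s, 0 < a.2.2.2.2.2 := by
  induction s with
  | zero => simp [history_zero]
  | succ s ih =>
    rw [history_succ, stageStep]
    cases guess s.unpair.1 s.unpair.2.unpair.1 s with
    | none => exact ih
    | some l =>
      simp only [Option.elim]
      cases mayAct _ _ _ _ _ l with
      | false => exact ih
      | true =>
        simp only [cond_true, List.mem_cons]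
        rintro a (rfl | ha)
        · exact NNRat.den_pos _
        · exact ih a ha

theorem reqState_den_pos (e : ℕ) {H : List FlipAction} (h : ∀ a ∈ H, 0 < a.2.2.2.2.2) :
    0 < (reqState e H).2.2.2.2 := by
  induction H with
  | nil => exact one_pos
  | cons a H ih =>
    have := ih fun b hb => h b (List.mem_cons_of_mem _ hb)
    have ha := h a List.mem_cons_self
    rw [reqState, List.foldr_cons, ReqState.update]
    split_ifs
    · exact one_pos
    · exact Nat.mul_pos this ha
    · exact this

theorem spent_den_pos (c d : CostFunction) (e s : ℕ) :
    (0 : ℚ≥0) < (reqState e (history c d s)).2.2.2.2 := by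
  exact_mod_cast reqState_den_pos e (entry_den_pos c d s)

theorem two_pow_mul_spent_lt_iff {c d : CostFunction} {m e s : ℕ} :
    (reqState e (history c d s)).2.2.2.1 * 2 ^ m < 2 * (reqState e (history c d s)).2.2.2.2 ↔
      2 ^ m * spent c d e s < 2 := by
  have h1 := spent_den_pos c d e s
  have h2 : (2 : ℝ≥0∞) ^ m * spent c d e s = (((2 ^ m * ((reqState e (history c d s)).2.2.2.1 /
      (reqState e (history c d s)).2.2.2.2 : ℚ≥0) : ℚ≥0) : ℝ≥0) : ℝ≥0∞) := by
    simp only [spent, NNRat.cast_mul, NNRat.cast_pow, NNRat.cast_ofNat, ENNReal.coe_mul,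
      ENNReal.coe_pow, ENNReal.coe_ofNat]
  have h3 : (2 : ℝ≥0∞) = (((2 : ℚ≥0) : ℝ≥0) : ℝ≥0∞) := by simp
  rw [h2, h3, ENNReal.coe_lt_coe, NNRat.cast_lt, ← mul_div_assoc, div_lt_iff₀ h1, mul_comm]
  norm_cast

theorem actsAt_of_mayAct {c d : CostFunction} {s e x t : ℕ} (he : e = s.unpair.1)
    (ht : t = s.unpair.2.unpair.1) (hx : x = candidate c d s (history c d s)) :
    (∃ l, guess e t s = some l ∧ mayAct (e + restraint c d e s) t x
      (reqState e (history c d s)) (approx c d s) l = true) → ActsAt c d s e x t := by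
  rintro ⟨l, hl, hact⟩
  have hh : history c d (s + 1) =
      (s, e, x, t, (c.cost x (s + 1)).num, (c.cost x (s + 1)).den) :: history c d s := by
    rw [history_succ, stageStep]
    simp only [← he, ← ht, ← hx, hl, Option.elim]
    rw [show (reqState e (history c d s)).1 = restraint c d e s from rfl,
      show flipped (history c d s) = approx c d s from rfl, hact]
    rfl
  simp only [mayAct, Bool.and_eq_true, decide_eq_true_eq, beq_iff_eq, decide_eq_decide,
    two_pow_mul_spent_lt_iff] at hact
  obtain ⟨h1, h2, h3, h4, h5⟩ := hact
  have hx' : x = firstBelow (suitable c d (e + restraint c d e s) (restraint c d e s) s t)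
      (t + 1) := by rw [hx, he, ht]; rfl
  have hs := firstBelow_spec (hx' ▸ Nat.lt_succ_of_le h2 : firstBelow (suitable c d
    (e + restraint c d e s) (restraint c d e s) s t) (t + 1) < t + 1)
  rw [← hx', suitable_iff] at hs
  refine ⟨?_, ⟨l, hl, h3, h4⟩, h1, h2, hs.1, hs.2.1, hs.2.2, fun y hy => ?_, h5, hh⟩
  · rw [ht]
    exact (Nat.unpair_left_le _).trans (Nat.unpair_right_le _)
  · by_contra hcon
    rw [Bool.not_eq_false] at hcon
    exact absurd (firstBelow_le_of (n := t + 1) hcon) (by omega)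

/-- At each stage nothing happens, or some requirement acts. -/
theorem history_succ_cases (c d : CostFunction) (s : ℕ) :
    history c d (s + 1) = history c d s ∨ ∃ e x t, ActsAt c d s e x t := by
  by_cases h : ∃ l, guess s.unpair.1 s.unpair.2.unpair.1 s = some l ∧
    mayAct (s.unpair.1 + restraint c d s.unpair.1 s) s.unpair.2.unpair.1
      (candidate c d s (history c d s)) (reqState s.unpair.1 (history c d s)) (approx c d s) l
  · exact Or.inr ⟨_, _, _, actsAt_of_mayAct rfl rfl rfl h⟩
  · refine Or.inl ?_
    rw [history_succ, stageStep]
    cases hg : guess s.unpair.1 s.unpair.2.unpair.1 s with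
    | none => rfl
    | some l =>
      have : mayAct (s.unpair.1 + restraint c d s.unpair.1 s) s.unpair.2.unpair.1
          (candidate c d s (history c d s)) (reqState s.unpair.1 (history c d s))
          (approx c d s) l = false := by
        by_contra hcon
        exact h ⟨l, hg, by simpa using hcon⟩
      simp only [Option.elim]
      rw [show (reqState s.unpair.1 (history c d s)).1 = restraint c d s.unpair.1 s from rfl,
        show flipped (history c d s) = approx c d s from rfl, this]
      rfl

/-- A sufficient condition for an action. -/
theorem exists_actsAt {c d : CostFunction} {e t k z : ℕ} {l : List ℕ}
    (hg : guess e t (Nat.pair e (Nat.pair t k)) = some l)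
    (hb : nextBound c d e (Nat.pair e (Nat.pair t k)) ≤ t) (hz : z ≤ t)
    (hsz : suitable c d (e + restraint c d e (Nat.pair e (Nat.pair t k)))
      (restraint c d e (Nat.pair e (Nat.pair t k))) (Nat.pair e (Nat.pair t k)) t z = true)
    (hl : ∀ y ≤ z, (y ∈ l ↔ y ∈ approx c d (Nat.pair e (Nat.pair t k))))
    (hlast : lastPoint c d e (Nat.pair e (Nat.pair t k)) ∈ l ↔
      lastPoint c d e (Nat.pair e (Nat.pair t k)) ∈ approx c d (Nat.pair e (Nat.pair t k)))
    (hspent : 2 ^ (e + restraint c d e (Nat.pair e (Nat.pair t k))) *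
      spent c d e (Nat.pair e (Nat.pair t k)) < 2) :
    ∃ x, ActsAt c d (Nat.pair e (Nat.pair t k)) e x t := by
  set s := Nat.pair e (Nat.pair t k) with hs
  have he : e = s.unpair.1 := by simp [hs]
  have ht : t = s.unpair.2.unpair.1 := by simp [hs]
  have hle : candidate c d s (history c d s) ≤ z := by
    rw [candidate]
    simp only [← he, ← ht]
    exact firstBelow_le_of hsz
  refine ⟨_, actsAt_of_mayAct he ht rfl ⟨l, hg, ?_⟩⟩
  simp only [mayAct, Bool.and_eq_true, decide_eq_true_eq, beq_iff_eq, decide_eq_decide,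
    two_pow_mul_spent_lt_iff]
  exact ⟨hb, hle.trans hz, hl _ hle, hlast, hspent⟩

/-! ### The effect of one action -/

section Effects

variable {c d : CostFunction} {s e x t : ℕ}

theorem ActsAt.reqState_succ (h : ActsAt c d s e x t) (e' : ℕ) :
    reqState e' (history c d (s + 1)) = ReqState.update e'
      (s, e, x, t, (c.cost x (s + 1)).num, (c.cost x (s + 1)).den)
      (reqState e' (history c d s)) := by
  rw [h.history_eq]; rfl

theorem ActsAt.reqState_of_lt (h : ActsAt c d s e x t) {e' : ℕ} (he : e < e') :
    reqState e' (history c d (s + 1)) = (s + 1, 0, 0, 0, 1) := by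
  rw [h.reqState_succ, ReqState.update, if_pos he]

theorem ActsAt.reqState_of_gt (h : ActsAt c d s e x t) {e' : ℕ} (he : e' < e) :
    reqState e' (history c d (s + 1)) = reqState e' (history c d s) := by
  rw [h.reqState_succ, ReqState.update, if_neg (by simpa using he.le),
    if_neg (by simpa using he.ne')]

theorem ActsAt.restraint_self (h : ActsAt c d s e x t) :
    restraint c d e (s + 1) = restraint c d e s := by
  rw [restraint, h.reqState_succ, ReqState.update, if_neg (by simp), if_pos rfl]; rfl

theorem ActsAt.nextBound_self (h : ActsAt c d s e x t) : nextBound c d e (s + 1) = t + 1 := by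
  rw [nextBound, h.reqState_succ, ReqState.update, if_neg (by simp), if_pos rfl]

theorem ActsAt.lastPoint_self (h : ActsAt c d s e x t) : lastPoint c d e (s + 1) = x := by
  rw [lastPoint, h.reqState_succ, ReqState.update, if_neg (by simp), if_pos rfl]

theorem ActsAt.spent_self (h : ActsAt c d s e x t) :
    spent c d e (s + 1) = spent c d e s + c.ecost x (s + 1) := by
  have h1 := spent_den_pos c d e s
  have h2 : (0 : ℚ≥0) < (c.cost x (s + 1)).den := by exact_mod_cast (c.cost x (s + 1)).den_pos
  rw [spent, h.reqState_succ, ReqState.update, if_neg (by simp), if_pos rfl, spent,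
    CostFunction.ecost, ← ENNReal.coe_add, ← NNRat.cast_add]
  congr 2
  conv_rhs => rw [← NNRat.num_div_den (c.cost x (s + 1)), div_add_div _ _ h1.ne' h2.ne']
  push_cast
  ring

theorem ActsAt.restraint_of_lt (h : ActsAt c d s e x t) {e' : ℕ} (he : e < e') :
    restraint c d e' (s + 1) = s + 1 := by rw [restraint, h.reqState_of_lt he]

theorem ActsAt.spent_of_lt (h : ActsAt c d s e x t) {e' : ℕ} (he : e < e') :
    spent c d e' (s + 1) = 0 := by rw [spent, h.reqState_of_lt he]; simp

theorem ActsAt.mem_approx_succ (h : ActsAt c d s e x t) (y : ℕ) :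
    y ∈ approx c d (s + 1) ↔ if y = x then x ∉ approx c d s else y ∈ approx c d s := by
  rw [approx, h.history_eq, flipped, List.foldr_cons, mem_setMem]
  simp only [Bool.not_eq_true', decide_eq_false_iff_not]
  rfl

end Effects

/-! ### Finite injury and convergence -/

section Dynamics

variable {c d : CostFunction}

theorem reqState_succ_eq {e s : ℕ} (h : ∀ e' ≤ e, ∀ x t, ¬ActsAt c d s e' x t) :
    reqState e (history c d (s + 1)) = reqState e (history c d s) := by
  rcases history_succ_cases c d s with h1 | ⟨e', x, t, h1⟩
  · rw [h1]
  · refine h1.reqState_of_gt ?_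
    by_contra! hle
    exact h e' hle x t h1

theorem reqState_eq_of_le {e S s : ℕ} (h : ∀ e' ≤ e, ∀ s, S ≤ s → ∀ x t, ¬ActsAt c d s e' x t)
    (hs : S ≤ s) : reqState e (history c d s) = reqState e (history c d S) := by
  induction s, hs using Nat.le_induction with
  | base => rfl
  | succ s hs ih => rw [reqState_succ_eq fun e' he' => h e' he' s hs, ih]

theorem restraint_succ_cases (c d : CostFunction) (e s : ℕ) :
    restraint c d e (s + 1) = restraint c d e s ∨ restraint c d e (s + 1) = s + 1 := by
  rcases history_succ_cases c d s with h1 | ⟨e', x, t, h1⟩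
  · exact Or.inl (by rw [restraint, h1]; rfl)
  · rcases lt_trichotomy e' e with h | rfl | h
    · exact Or.inr (h1.restraint_of_lt h)
    · exact Or.inl h1.restraint_self
    · exact Or.inl (by rw [restraint, h1.reqState_of_gt h]; rfl)

theorem restraint_le (c d : CostFunction) (e s : ℕ) : restraint c d e s ≤ s := by
  induction s with
  | zero => exact le_rfl
  | succ s ih => rcases restraint_succ_cases c d e s with h | h <;> omega

theorem restraint_mono (c d : CostFunction) (e : ℕ) : Monotone (restraint c d e) :=
  monotone_nat_of_le_succ fun s => by
    have := restraint_le c d e s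
    rcases restraint_succ_cases c d e s with h | h <;> omega

/-- An action at stage `s` moves an element at most `s` and raises all weaker restraints to `s + 1`;
restraints never drop. -/
theorem ActsAt.lt_restraint {s e x t : ℕ} (h : ActsAt c d s e x t) {e' s' : ℕ} (he : e < e')
    (hs : s < s') : x < restraint c d e' s' := by
  have h1 := h.restraint_of_lt he
  have h2 := restraint_mono c d e' (Nat.succ_le_of_lt hs)
  have h3 := h.point_le
  have h4 := h.stage_le
  simp only [Nat.succ_eq_add_one] at h2
  omega

/-- Only a stronger requirement can reset the state. -/
theorem state_mono_succ {e s : ℕ} (h : ∀ e' < e, ∀ x t, ¬ActsAt c d s e' x t) :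
    restraint c d e (s + 1) = restraint c d e s ∧ nextBound c d e s ≤ nextBound c d e (s + 1) ∧
      spent c d e s ≤ spent c d e (s + 1) := by
  by_cases hact : ∃ x t, ActsAt c d s e x t
  · obtain ⟨x, t, hact⟩ := hact
    refine ⟨hact.restraint_self, ?_, ?_⟩
    · rw [hact.nextBound_self]
      exact hact.bound_le.trans t.le_succ
    · rw [hact.spent_self]
      exact le_self_add
  · have := reqState_succ_eq (e := e) (s := s) fun e' he' x t hx => by
      rcases he'.lt_or_eq with h' | rfl
      · exact h e' h' x t hx
      · exact hact ⟨x, t, hx⟩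
    simp only [restraint, nextBound, spent, this, le_refl, and_self]

theorem state_mono {e S s s' : ℕ} (h : ∀ e' < e, ∀ s, S ≤ s → ∀ x t, ¬ActsAt c d s e' x t)
    (hs : S ≤ s) (hs' : s ≤ s') :
    restraint c d e s' = restraint c d e s ∧ nextBound c d e s ≤ nextBound c d e s' ∧
      spent c d e s ≤ spent c d e s' := by
  induction s', hs' using Nat.le_induction with
  | base => exact ⟨rfl, le_rfl, le_rfl⟩
  | succ u hu ih =>
    obtain ⟨h1, h2, h3⟩ := state_mono_succ fun e' he' => h e' he' u (hs.trans hu)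
    exact ⟨h1.trans ih.1, ih.2.1.trans h2, ih.2.2.trans h3⟩

theorem exists_uniform_bound {P : ℕ → ℕ → Prop} {n : ℕ} (h : ∀ e < n, ∃ S, ∀ s, S ≤ s → P e s) :
    ∃ S, ∀ e < n, ∀ s, S ≤ s → P e s := by
  have : ∀ᶠ s in atTop, ∀ e ∈ Finset.range n, P e s :=
    (Filter.eventually_all_finset _).2 fun e he =>
      eventually_atTop.2 (h e (Finset.mem_range.1 he))
  obtain ⟨S, hS⟩ := eventually_atTop.1 this
  exact ⟨S, fun e he s hs => hS s hs e (Finset.mem_range.2 he)⟩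

theorem exists_pos_lower_bound (hc : c.NondecreasingInStage) (hp : c.Proper) (n : ℕ) :
    ∃ S, ∃ δ : ℝ≥0∞, δ ≠ 0 ∧ ∀ y < n, ∀ s, S ≤ s → δ ≤ c.ecost y s := by
  induction n with
  | zero => exact ⟨0, 1, one_ne_zero, by simp⟩
  | succ n ih =>
    obtain ⟨S, δ, hδ, h⟩ := ih
    obtain ⟨t, ht⟩ := hp n
    have ht' : c.ecost n t ≠ 0 := by
      simp only [CostFunction.ecost, ne_eq, ENNReal.coe_eq_zero, NNRat.cast_eq_zero]
      exact ht.ne'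
    refine ⟨max S t, min δ (c.ecost n t), ?_, fun y hy s hs => ?_⟩
    · rcases min_choice δ (c.ecost n t) with h' | h' <;> rw [h'] <;> assumption
    · rcases Nat.lt_succ_iff_lt_or_eq.1 hy with hy | rfl
      · exact (min_le_left _ _).trans (h y hy s (le_trans (le_max_left _ _) hs))
      · exact (min_le_right _ _).trans
          (CostFunction.ecost_mono hc y (le_trans (le_max_right _ _) hs))

/-- There are elements at which `d` is permanently much larger than `c`. -/
def HasSuitable (c d : CostFunction) : Prop :=
  ∀ m r, ∃ x T, x ≤ T ∧ ∀ s t, T ≤ t → suitable c d m r s t x = true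

/-- Each requirement acts only finitely often. -/
theorem eventually_not_actsAt (hc : c.NondecreasingInStage) (hp : c.Proper)
    (hsuit : HasSuitable c d) (e : ℕ) :
    ∃ S, ∀ s, S ≤ s → ∀ x t, ¬ActsAt c d s e x t := by
  induction e using Nat.strong_induction_on with
  | _ e ih =>
  obtain ⟨S₀, hS₀⟩ := exists_uniform_bound ih
  -- Once `t ≥ T`, the element `z` is always available, so the least suitable element never exceeds
  -- it. Each further action then costs at least a fixed `δ > 0`, and the bound on the amount spent
  -- is eventually violated.
  obtain ⟨z, T, -, hz⟩ := hsuit (e + restraint c d e S₀) (restraint c d e S₀)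
  obtain ⟨S₁, δ, hδ, hlow⟩ := exists_pos_lower_bound hc hp (z + 1)
  by_contra! hinf
  have hr : ∀ s, S₀ ≤ s → restraint c d e s = restraint c d e S₀ := fun s hs =>
    (state_mono hS₀ le_rfl hs).1
  have hbound : ∀ n, ∃ s, S₀ ≤ s ∧ n ≤ nextBound c d e s := by
    intro n
    induction n with
    | zero => exact ⟨S₀, le_rfl, Nat.zero_le _⟩
    | succ n ihn =>
      obtain ⟨s, hs, hn⟩ := ihn
      obtain ⟨u, hu, x, t, hact⟩ := hinf s
      refine ⟨u + 1, by omega, ?_⟩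
      have h1 := (state_mono hS₀ hs hu).2.1
      have h2 := hact.bound_le
      -- Each action raises the bound on the opponent's stage by at least one, so that `t ≥ T` is
      -- eventually guaranteed.
      rw [hact.nextBound_self]
      omega
  obtain ⟨S₂, hS₂, hT⟩ := hbound T
  have hspent : ∀ n : ℕ, ∃ s, max S₁ S₂ ≤ s ∧ n * δ ≤ spent c d e s := by
    intro n
    induction n with
    | zero => exact ⟨_, le_rfl, by simp⟩
    | succ n ihn =>
      obtain ⟨s, hs, hn⟩ := ihn
      obtain ⟨u, hu, x, t, hact⟩ := hinf s
      have hs1 : S₁ ≤ s := (le_max_left _ _).trans hs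
      have hs2 : S₂ ≤ s := (le_max_right _ _).trans hs
      refine ⟨u + 1, by omega, ?_⟩
      have hmono := state_mono hS₀ (hS₂.trans hs2) hu
      have hTt : T ≤ t := (hT.trans (state_mono hS₀ hS₂ (hs2.trans hu)).2.1).trans hact.bound_le
      have hx : x < z + 1 := by
        by_contra! hlt
        have h1 := hact.least z (by omega)
        rw [hr u (by omega), hz u t hTt] at h1
        exact absurd h1 (by simp)
      rw [hact.spent_self, Nat.cast_succ, add_mul, one_mul]
      exact add_le_add (hn.trans hmono.2.2) (hlow x hx _ (by omega))
  obtain ⟨n, hn⟩ := ENNReal.exists_nat_mul_gt hδ (show (2 : ℝ≥0∞) ≠ ⊤ by simp)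
  obtain ⟨s, hs, hns⟩ := hspent n
  obtain ⟨u, hu, x, t, hact⟩ := hinf s
  have hs2 : S₂ ≤ s := (le_max_right _ _).trans hs
  have h1 := (state_mono hS₀ (hS₂.trans hs2) hu).2.2
  have h2 := hact.spent_lt
  have h3 : spent c d e u ≤ 2 ^ (e + restraint c d e u) * spent c d e u :=
    le_mul_of_one_le_left zero_le (one_le_pow₀ one_le_two)
  exact absurd ((hn.trans_le (hns.trans h1)).trans_le h3) (not_lt.2 h2.le)

theorem eventually_forall_not_actsAt (hc : c.NondecreasingInStage) (hp : c.Proper)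
    (hsuit : HasSuitable c d) (e : ℕ) :
    ∃ S, ∀ e' ≤ e, ∀ s, S ≤ s → ∀ x t, ¬ActsAt c d s e' x t := by
  obtain ⟨S, hS⟩ := exists_uniform_bound (n := e + 1)
    fun e' _ => eventually_not_actsAt hc hp hsuit e'
  exact ⟨S, fun e' he' => hS e' (Nat.lt_succ_of_le he')⟩

/-- The membership of each element is eventually constant. -/
theorem approx_eventually_const (hc : c.NondecreasingInStage) (hp : c.Proper)
    (hsuit : HasSuitable c d) (x : ℕ) :
    ∃ S, ∀ s, S ≤ s → (x ∈ approx c d s ↔ x ∈ approx c d S) := by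
  have key : ∃ S, ∀ s, S ≤ s → ∀ e t, ¬ActsAt c d s e x t := by
    by_cases h : ∃ s e t, ActsAt c d s e x t
    · obtain ⟨s₀, e₀, t₀, h₀⟩ := h
      -- After `e₀` has once flipped `x`, weaker requirements are restrained from `x`; only the
      -- finitely many requirements up to `e₀` matter.
      obtain ⟨S, hS⟩ := eventually_forall_not_actsAt hc hp hsuit e₀
      refine ⟨max S (s₀ + 1), fun s hs e t hact => ?_⟩
      by_cases he : e ≤ e₀
      · exact hS e he s (le_trans (le_max_left _ _) hs) x t hact
      · have h1 := h₀.lt_restraint (not_le.1 he) (le_trans (le_max_right _ _) hs)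
        exact absurd hact.restraint_le (not_le.2 h1)
    · push Not at h
      exact ⟨0, fun s _ => h s⟩
  obtain ⟨S, hS⟩ := key
  refine ⟨S, fun s hs => ?_⟩
  induction s, hs using Nat.le_induction with
  | base => rfl
  | succ s hs ih =>
    rw [← ih]
    rcases history_succ_cases c d s with h1 | ⟨e, y, t, h1⟩
    · rw [approx, h1]; rfl
    · rw [h1.mem_approx_succ, if_neg]
      rintro rfl
      exact hS s hs e t h1

/-- The limit of the constructed approximation. -/
def limitSet (c d : CostFunction) : Set ℕ := {x | ∀ᶠ s in atTop, x ∈ approx c d s}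

theorem eventually_mem_approx_iff (hc : c.NondecreasingInStage) (hp : c.Proper)
    (hsuit : HasSuitable c d) (x : ℕ) :
    ∀ᶠ s in atTop, (x ∈ approx c d s ↔ x ∈ limitSet c d) := by
  obtain ⟨S, hS⟩ := approx_eventually_const hc hp hsuit x
  refine eventually_atTop.2 ⟨S, fun s hs => ⟨fun h => ?_, fun h => ?_⟩⟩
  · exact eventually_atTop.2 ⟨S, fun u hu => (hS u hu).2 ((hS s hs).1 h)⟩
  · obtain ⟨u, hu, hu'⟩ := ((eventually_ge_atTop S).and h).exists
    exact (hS s hs).2 ((hS u hu).1 hu')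

theorem isComputableApprox_approx (hc : c.NondecreasingInStage) (hp : c.Proper)
    (hsuit : HasSuitable c d) :
    IsComputableApprox (fun s => (approx c d s).toFinset) (limitSet c d) := by
  refine ⟨⟨approx c d, flipped_primrec.to_comp.comp (history_computable c d), fun _ => rfl⟩,
    fun x => ?_⟩
  filter_upwards [eventually_mem_approx_iff hc hp hsuit x] with s hs
  rw [List.mem_toFinset, hs]

end Dynamics

/-! ### The constructed set obeys `c` -/

section Cost

variable {c d : CostFunction}

theorem ActsAt.changeCost_le {s e x t : ℕ} (h : ActsAt c d s e x t) :
    changeCost c (fun s => (approx c d s).toFinset) (s + 1) ≤ c.ecost x (s + 1) := by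
  refine _root_.changeCost_le fun y _ hy => ?_
  simp [h.mem_approx_succ, hy]

open Classical in
/-- The cost of the actions of the requirement `e` under the restraint `r` before stage `s`. -/
noncomputable def epochCost (c d : CostFunction) (e r s : ℕ) : ℝ≥0∞ :=
  ∑ u ∈ Finset.range s, if (∃ x t, ActsAt c d u e x t) ∧ restraint c d e u = r then
    changeCost c (fun s => (approx c d s).toFinset) (u + 1) else 0

theorem epochCost_succ_of_not {e r s : ℕ}
    (h : ¬((∃ x t, ActsAt c d s e x t) ∧ restraint c d e s = r)) :
    epochCost c d e r (s + 1) = epochCost c d e r s := by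
  rw [epochCost, Finset.sum_range_succ, if_neg h, add_zero, epochCost]

/-- A reset strictly increases the restraint, so the actions under restraint `r` form a single
epoch, during which `spent` records their cost. The third bound survives the epoch: below `2 * 2^-m`
before the last action, plus at most `2^-m` for it. -/
theorem epochCost_bounds (c d : CostFunction) (e r s : ℕ) :
    (restraint c d e s < r → epochCost c d e r s = 0) ∧
      (restraint c d e s = r → epochCost c d e r s ≤ spent c d e s) ∧
      2 ^ (e + r) * epochCost c d e r s ≤ 3 := by
  induction s with
  | zero => simp [epochCost]
  | succ s ih =>
    obtain ⟨ih1, ih2, ih3⟩ := ih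
    by_cases hact : ∃ x t, ActsAt c d s e x t
    · obtain ⟨x, t, h⟩ := hact
      rw [h.restraint_self]
      by_cases hr : restraint c d e s = r
      · have hsum : epochCost c d e r (s + 1) ≤ spent c d e s + c.ecost x (s + 1) := by
          rw [epochCost, Finset.sum_range_succ, if_pos ⟨⟨x, t, h⟩, hr⟩]
          exact add_le_add (ih2 hr) h.changeCost_le
        refine ⟨fun h' => absurd hr h'.ne, fun _ => by rwa [h.spent_self], ?_⟩
        have h1 := h.spent_lt
        have h2 := h.cheap
        rw [hr] at h1 h2
        calc _ ≤ 2 ^ (e + r) * (spent c d e s + c.ecost x (s + 1)) := mul_le_mul_right hsum _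
          _ ≤ 2 + 1 := by rw [mul_add]; exact add_le_add h1.le h2
          _ = 3 := by norm_num
      · rw [epochCost_succ_of_not fun h' => hr h'.2]
        exact ⟨ih1, fun h' => absurd h' hr, ih3⟩
    · rw [epochCost_succ_of_not fun h' => hact h'.1]
      have hle := restraint_le c d e s
      rcases history_succ_cases c d s with h1 | ⟨e', x, t, h1⟩
      · simp only [restraint, spent, h1]
        exact ⟨ih1, ih2, ih3⟩
      · rcases lt_trichotomy e' e with h | rfl | h
        · rw [h1.restraint_of_lt h]
          refine ⟨fun h' => ih1 (by omega), fun h' => ?_, ih3⟩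
          rw [ih1 (by omega)]
          exact zero_le
        · exact absurd ⟨x, t, h1⟩ hact
        · simp only [restraint, spent, h1.reqState_of_gt h]
          exact ⟨ih1, ih2, ih3⟩

theorem epochCost_le (c d : CostFunction) (e r s : ℕ) :
    epochCost c d e r s ≤ 3 * (2⁻¹ ^ e * 2⁻¹ ^ r) := by
  have h := (epochCost_bounds c d e r s).2.2
  rw [← pow_add, ← ENNReal.inv_pow, ← div_eq_mul_inv]
  rw [mul_comm] at h
  exact (ENNReal.le_div_iff_mul_le (Or.inl (by positivity)) (Or.inl (by finiteness))).2 h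

/-- Every change belongs to exactly one acting requirement and its current restraint; interchanging
sums leaves a double geometric series. -/
theorem totalCost_approx_lt_top (c d : CostFunction) :
    totalCost c (fun s => (approx c d s).toFinset) < ⊤ := by
  classical
  let f : ℕ → ℕ → ℕ → ℝ≥0∞ := fun e r u =>
    if (∃ x t, ActsAt c d u e x t) ∧ restraint c d e u = r then
      changeCost c (fun s => (approx c d s).toFinset) (u + 1) else 0
  have h1 : ∀ u, changeCost c (fun s => (approx c d s).toFinset) (u + 1) ≤
      ∑' e, ∑' r, f e r u := by
    intro u
    rcases history_succ_cases c d u with h | ⟨e, x, t, h⟩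
    · rw [changeCost_eq_zero]
      · exact zero_le
      · intro y _
        simp [approx, h]
    · calc _ = f e (restraint c d e u) u := (if_pos ⟨⟨x, t, h⟩, rfl⟩).symm
        _ ≤ ∑' r, f e r u := ENNReal.le_tsum _
        _ ≤ _ := ENNReal.le_tsum (f := fun e => ∑' r, f e r u) e
  have h2 : ∀ e r, ∑' u, f e r u ≤ 3 * (2⁻¹ ^ e * 2⁻¹ ^ r) := by
    intro e r
    rw [ENNReal.tsum_eq_iSup_nat]
    refine iSup_le fun s => le_trans (le_of_eq ?_) (epochCost_le c d e r s)
    simp only [epochCost, f]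
  calc totalCost c (fun s => (approx c d s).toFinset) ≤ ∑' u, ∑' e, ∑' r, f e r u :=
        ENNReal.tsum_le_tsum h1
    _ = ∑' e, ∑' r, ∑' u, f e r u := by
        rw [ENNReal.tsum_comm]
        exact tsum_congr fun e => ENNReal.tsum_comm
    _ ≤ ∑' e, ∑' r, 3 * (2⁻¹ ^ e * 2⁻¹ ^ r) :=
        ENNReal.tsum_le_tsum fun e => ENNReal.tsum_le_tsum fun r => h2 e r
    _ < ⊤ := by
        simp only [ENNReal.tsum_mul_left, ENNReal.tsum_mul_right, ENNReal.tsum_geometric,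
          ENNReal.one_sub_inv_two, inv_inv]
        finiteness

end Cost

/-! ### The constructed set does not obey `d` -/

section Diagonalization

variable {c d : CostFunction}

/-- The least changed element is at most `x`, and monotonicity in the main argument makes it at
least as expensive. -/
theorem ecost_le_changeCost (hd : d.NonincreasingInMain) {A : ℕ → Finset ℕ} {x s : ℕ} (hx : x < s)
    (h : ¬(x ∈ A (s - 1) ↔ x ∈ A s)) : d.ecost x s ≤ changeCost d A s := by
  classical
  have hex : ∃ x, x < s ∧ ¬(x ∈ A (s - 1) ↔ x ∈ A s) := ⟨x, hx, h⟩
  have hanti : Antitone fun y => d.ecost y s := antitone_nat_of_succ_le fun y => by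
    simp only [CostFunction.ecost]
    exact_mod_cast hd y s
  rw [changeCost, dif_pos hex]
  exact hanti (Nat.find_min' hex ⟨hx, h⟩)

/-- What the opponent `B` of the requirement `e` has paid until stage `s`. -/
def OpponentPays (c d : CostFunction) (B : ℕ → Finset ℕ) (e s : ℕ) : Prop :=
  -- Here `p` is the opponent's stage used in the last action and `lc` the cost of that action, the
  -- only one perhaps still unanswered.
  spent c d e s = 0 ∨ ∃ (p : ℕ) (lc : ℝ≥0∞),
    nextBound c d e s = p + 1 ∧ lastPoint c d e s ≤ p ∧
    4 ^ (e + restraint c d e s) * spent c d e s ≤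
      (∑ u ∈ Finset.range p, changeCost d B (u + 1)) + 4 ^ (e + restraint c d e s) * lc ∧
    4 ^ (e + restraint c d e s) * lc ≤ d.ecost (lastPoint c d e s) p ∧
    2 ^ (e + restraint c d e s) * lc ≤ 1 ∧
    (lastPoint c d e s ∈ B p ↔ lastPoint c d e s ∉ approx c d s) ∧
    ∀ e', e < e' → lastPoint c d e s < restraint c d e' s

theorem sum_changeCost_ge (hd : d.NondecreasingInStage) (hd' : d.NonincreasingInMain)
    {B : ℕ → Finset ℕ} {x p t : ℕ} (hx : x ≤ p) (hpt : p ≤ t) (h : ¬(x ∈ B p ↔ x ∈ B t)) :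
    (∑ u ∈ Finset.range p, changeCost d B (u + 1)) + d.ecost x p ≤
      ∑ u ∈ Finset.range t, changeCost d B (u + 1) := by
  obtain ⟨u, h1, h2, h3⟩ := exists_change hpt h
  rw [← Finset.sum_range_add_sum_Ico _ hpt]
  refine add_le_add le_rfl ?_
  calc d.ecost x p ≤ d.ecost x (u + 1) := CostFunction.ecost_mono hd x (by omega)
    _ ≤ changeCost d B (u + 1) := ecost_le_changeCost hd' (by omega) h3
    _ ≤ _ := Finset.single_le_sum (f := fun u => changeCost d B (u + 1))
      (fun _ _ => zero_le) (Finset.mem_Ico.2 ⟨h1, h2⟩)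

/-- When `e` acts again, `B` at `t` agrees with the set at the last point, where it disagreed at `p
< t`. So `B` has changed there after `p`, and the pending term turns into a payment disjoint from
the earlier ones. Stronger actions reset the amount spent, and weaker ones respect the last point.
-/
theorem opponentPays (hd : d.NondecreasingInStage) (hd' : d.NonincreasingInMain)
    {B : ℕ → Finset ℕ} {L : ℕ → List ℕ} (hLB : ∀ s, (L s).toFinset = B s) {e : ℕ}
    (hg : ∀ t s v, guess e t s = some v → v = L t) (s : ℕ) : OpponentPays c d B e s := by
  induction s with
  | zero => exact Or.inl (by simp [spent, history_zero, reqState])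
  | succ s ih =>
    rcases history_succ_cases c d s with h1 | ⟨e', x, t, h1⟩
    · simpa only [OpponentPays, spent, nextBound, lastPoint, restraint, approx, h1] using ih
    rcases lt_trichotomy e' e with h | rfl | h
    · exact Or.inl (h1.spent_of_lt h)
    · obtain ⟨l, hl, hx, hlast⟩ := h1.exists_guess
      obtain rfl := hg _ _ _ hl
      have hmemB : ∀ y u, y ∈ L u ↔ y ∈ B u := fun y u => by rw [← hLB, List.mem_toFinset]
      rw [hmemB] at hx hlast
      refine Or.inr ⟨t, c.ecost x (s + 1), h1.nextBound_self, ?_⟩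
      rw [h1.lastPoint_self, h1.restraint_self, h1.spent_self, mul_add]
      refine ⟨h1.point_le, add_le_add ?_ le_rfl, h1.gain, h1.cheap, ?_, fun e'' he'' =>
        h1.lt_restraint he'' s.lt_succ_self⟩
      · rcases ih with h0 | ⟨p, lc, i1, i2, i3, i4, i5, i6, i7⟩
        · rw [h0, mul_zero]
          exact zero_le
        · have hb := h1.bound_le
          exact (i3.trans (add_le_add le_rfl i4)).trans
            (sum_changeCost_ge hd hd' i2 (by omega) (by tauto))
      · rw [h1.mem_approx_succ, if_pos rfl, not_not, hx]
    · have hst := h1.reqState_of_gt h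
      rcases ih with h0 | ⟨p, lc, i1, i2, i3, i4, i5, i6, i7⟩
      · exact Or.inl (by rw [← h0, spent, hst]; rfl)
      · have hlp : lastPoint c d e (s + 1) = lastPoint c d e s := by rw [lastPoint, hst]; rfl
        have hre : restraint c d e (s + 1) = restraint c d e s := by rw [restraint, hst]; rfl
        have hsp : spent c d e (s + 1) = spent c d e s := by rw [spent, hst]; rfl
        have hnb : nextBound c d e (s + 1) = nextBound c d e s := by rw [nextBound, hst]; rfl
        refine Or.inr ⟨p, lc, ?_⟩
        rw [hlp, hre, hsp, hnb, h1.mem_approx_succ,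
          if_neg ((i7 e' h).trans_le h1.restraint_le).ne]
        exact ⟨i1, i2, i3, i4, i5, i6, fun e'' he'' =>
          (i7 e'' he'').trans_le (restraint_mono c d e'' s.le_succ)⟩

/-- Otherwise the requirement, in its final state, would be stopped only by disagreement. But both
approximations converge to the same set, so they eventually agree at the last point and up to a
suitable `z`, which triggers a further action. -/
theorem exists_two_le_spent (hc : c.NondecreasingInStage) (hp : c.Proper)
    (hsuit : HasSuitable c d) {L : ℕ → List ℕ}
    (hL : ∀ x, ∀ᶠ s in atTop, (x ∈ L s ↔ x ∈ limitSet c d)) {e : ℕ}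
    (hg : ∀ t, ∃ k, ∀ s, k ≤ s → guess e t s = some (L t)) :
    ∃ s, 2 ≤ 2 ^ (e + restraint c d e s) * spent c d e s := by
  obtain ⟨S, hS⟩ := eventually_forall_not_actsAt hc hp hsuit e
  by_contra! hlt
  obtain ⟨z, T, hzT, hz⟩ := hsuit (e + restraint c d e S) (restraint c d e S)
  set n := max z (lastPoint c d e S) + 1 with hn
  obtain ⟨S₁, hS₁⟩ := exists_uniform_bound (n := n)
    (P := fun x s => (x ∈ approx c d s ↔ x ∈ limitSet c d))
    fun x _ => eventually_atTop.1 (eventually_mem_approx_iff hc hp hsuit x)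
  obtain ⟨T₁, hT₁⟩ := exists_uniform_bound (n := n)
    (P := fun x s => (x ∈ L s ↔ x ∈ limitSet c d)) fun x _ => eventually_atTop.1 (hL x)
  set t := T + T₁ + nextBound c d e S with ht
  obtain ⟨k₀, hk₀⟩ := hg t
  -- The dummy component pushes the stage past every threshold while `e` and `t` stay fixed.
  set k := k₀ + S + S₁ with hk
  have hks : k ≤ Nat.pair e (Nat.pair t k) :=
    (Nat.right_le_pair t k).trans (Nat.right_le_pair e _)
  have hst : reqState e (history c d (Nat.pair e (Nat.pair t k))) = reqState e (history c d S) :=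
    reqState_eq_of_le hS (by omega)
  have hre : restraint c d e (Nat.pair e (Nat.pair t k)) = restraint c d e S := by
    rw [restraint, hst]; rfl
  have hlp : lastPoint c d e (Nat.pair e (Nat.pair t k)) = lastPoint c d e S := by
    rw [lastPoint, hst]; rfl
  have hnb : nextBound c d e (Nat.pair e (Nat.pair t k)) = nextBound c d e S := by
    rw [nextBound, hst]; rfl
  have hmem : ∀ y < n, (y ∈ L t ↔ y ∈ approx c d (Nat.pair e (Nat.pair t k))) := fun y hy =>
    (hT₁ y hy t (by omega)).trans (hS₁ y hy _ (by omega)).symm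
  obtain ⟨x, hx⟩ := exists_actsAt (c := c) (d := d) (hk₀ _ (by omega)) (z := z)
    (by rw [hnb]; omega) (by omega) (by rw [hre]; exact hz _ t (by omega))
    (fun y hy => hmem y (by omega)) (by rw [hlp]; exact hmem _ (by omega)) (hlt _)
  exact hS e le_rfl _ (by omega) x t hx

theorem not_obeys_limitSet (hc : c.NondecreasingInStage) (hd : d.NondecreasingInStage)
    (hd' : d.NonincreasingInMain) (hp : c.Proper) (hsuit : HasSuitable c d) :
    ¬Obeys (limitSet c d) d := by
  rintro ⟨B, ⟨⟨L, hL, hLB⟩, hB⟩, hlt⟩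
  refine hlt.ne (ENNReal.eq_top_of_forall_nnreal_le fun r => ?_)
  obtain ⟨n, hn⟩ := exists_nat_ge r
  obtain ⟨e, hne, hg1, hg2⟩ := exists_guess hL n
  obtain ⟨s, hs⟩ := exists_two_le_spent hc hp hsuit (L := L)
    (fun x => (hB x).mono fun s hs => by rw [← hs, ← hLB, List.mem_toFinset]) hg2
  set m := e + restraint c d e s with hm
  rcases opponentPays hd hd' hLB hg1 s with h0 | ⟨p, lc, -, -, h3, -, h5, -, -⟩
  · rw [h0, mul_zero] at hs
    exact absurd hs (by simp)
  rw [← hm] at h3 h5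
  have h4 : (4 : ℝ≥0∞) ^ m = 2 ^ m * 2 ^ m := by rw [← mul_pow]; norm_num
  -- Spending `2 * 2^-m` at factor `4^m` demands `2 * 2^m`; the unanswered last flip accounts for at
  -- most `2^m` of it.
  have hle : (2 : ℝ≥0∞) ^ m + 2 ^ m ≤
      (∑ u ∈ Finset.range p, changeCost d B (u + 1)) + 2 ^ m := by
    calc (2 : ℝ≥0∞) ^ m + 2 ^ m = 2 ^ m * 2 := (mul_two _).symm
      _ ≤ 2 ^ m * (2 ^ m * spent c d e s) := mul_le_mul_right hs _
      _ = 4 ^ m * spent c d e s := by rw [h4, mul_assoc]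
      _ ≤ _ := h3
      _ ≤ _ := by
        refine add_le_add le_rfl ?_
        rw [h4, mul_assoc]
        exact (mul_le_mul_right h5 _).trans (mul_one _).le
  have hle' := (ENNReal.add_le_add_iff_right (by finiteness)).1 hle
  calc (r : ℝ≥0∞) ≤ n := by exact_mod_cast hn
    _ ≤ e := by exact_mod_cast hne
    _ ≤ (2 ^ m : ℕ) := by
      exact_mod_cast (Nat.le_add_right e _).trans (Nat.lt_two_pow_self (n := m)).le
    _ = 2 ^ m := by push_cast; rfl
    _ ≤ _ := hle'
    _ ≤ totalCost d B := ENNReal.sum_le_tsum _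

/-- On any finite initial segment some multiple of the positive limit of `c` exceeds the finite
limit of `d`. A failure for a large enough `N` thus occurs far out, where the limit condition makes
`c` small. -/
theorem hasSuitable (hc : c.NondecreasingInStage) (hd : d.NondecreasingInStage)
    (hlim : c.LimitCondition) (hp : c.Proper) (hfin : ∀ x, d.limit x < ⊤)
    (hN : ¬∃ N : ℕ, ∀ x, (N : ℝ≥0∞) * c.limit x > d.limit x) : HasSuitable c d := by
  intro m r
  have hpos : ∀ x, c.limit x ≠ 0 := fun x h0 => by
    obtain ⟨t, ht⟩ := hp x
    have h1 := CostFunction.ecost_le_limit hc x t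
    rw [h0, nonpos_iff_eq_zero] at h1
    simp only [CostFunction.ecost, ENNReal.coe_eq_zero, NNRat.cast_eq_zero] at h1
    exact ht.ne' h1
  have hev : ∀ᶠ x in atTop, c.limit x ≤ (2 ^ m)⁻¹ := by
    refine (hlim.eventually_lt_const (u := (2 ^ m)⁻¹) ?_).mono fun x hx => hx.le
    exact ENNReal.inv_pos.2 (by finiteness)
  obtain ⟨R, hR⟩ := eventually_atTop.1 hev
  choose g hg using fun x => ENNReal.exists_nat_mul_gt (hpos x) (hfin x).ne
  push Not at hN
  -- The sum excludes `x < max R r`; the extra `1` gives strict inequality, so that a finite stage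
  -- of `d` already beats `4 ^ m` times the limit of `c`.
  obtain ⟨x, hx⟩ := hN (4 ^ m + 1 + ∑ y ∈ Finset.range (max R r), g y)
  have hxR : max R r ≤ x := by
    by_contra! hlt
    refine absurd ((hg x).trans_le ((mul_le_mul_left ?_ _).trans hx)) (lt_irrefl _)
    have := Finset.single_le_sum (f := g) (fun _ _ => Nat.zero_le _) (Finset.mem_range.2 hlt)
    exact_mod_cast this.trans (Nat.le_add_left _ _)
  have hcx := hR x (le_trans (le_max_left _ _) hxR)
  have hctop : c.limit x ≠ ⊤ := (hcx.trans_lt (by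
    rw [ENNReal.inv_lt_top]; positivity)).ne
  have hlt : (4 : ℝ≥0∞) ^ m * c.limit x < d.limit x := by
    calc (4 : ℝ≥0∞) ^ m * c.limit x < 4 ^ m * c.limit x + c.limit x :=
          ENNReal.lt_add_right (by finiteness) (hpos x)
      _ = ((4 ^ m + 1 : ℕ) : ℝ≥0∞) * c.limit x := by push_cast; ring
      _ ≤ _ := mul_le_mul_left (by exact_mod_cast Nat.le_add_right _ _) _
      _ ≤ _ := hx
  rw [CostFunction.limit_eq_iSup d hd, lt_iSup_iff] at hlt
  obtain ⟨T, hT⟩ := hlt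
  refine ⟨x, max x T, le_max_left _ _, fun s t ht => suitable_iff.2
    ⟨(le_max_right _ _).trans hxR, ?_, ?_⟩⟩
  · calc _ ≤ 2 ^ m * (2 ^ m)⁻¹ :=
          mul_le_mul_right ((CostFunction.ecost_le_limit hc x _).trans hcx) _
      _ ≤ 1 := ENNReal.mul_inv_le_one _
  · calc _ ≤ 4 ^ m * c.limit x := mul_le_mul_right (CostFunction.ecost_le_limit hc x _) _
      _ ≤ d.ecost x T := hT.le
      _ ≤ _ := CostFunction.ecost_mono hd x ((le_max_right _ _).trans ht)

end Diagonalization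

theorem mainTheorem1 (c d : CostFunction)
    (hc : c.NondecreasingInStage) (hd : d.NondecreasingInStage) (hlim : c.LimitCondition) :
    ((∃ N : ℕ, ∀ x, (N : ℝ≥0∞) * c.limit x > d.limit x) → c.Implies d) ∧
      (d.NonincreasingInMain → c.Proper → (∀ x, d.limit x < ⊤) →
        (c.Implies d ↔ ∃ N : ℕ, ∀ x, (N : ℝ≥0∞) * c.limit x > d.limit x)) := by
  have h1 : (∃ N : ℕ, ∀ x, (N : ℝ≥0∞) * c.limit x > d.limit x) → c.Implies d :=
    fun ⟨_, hN⟩ => implies_of_forall_limit_lt hc hd hN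
  refine ⟨h1, fun hd' hp hfin => ⟨fun himp => ?_, h1⟩⟩
  by_contra hN
  have hsuit := hasSuitable hc hd hlim hp hfin hN
  exact not_obeys_limitSet hc hd hd' hp hsuit (himp _
    ⟨_, isComputableApprox_approx hc hp hsuit, totalCost_approx_lt_top c d⟩)
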